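/- Let $H$ be a real-valued function on $\mathbb{R}^2$, real analytic at the origin, with $H(0,0)=0$, such that the Hamiltonian system $$\dot x=-H_y(x,y),\qquad \dot y=H_x(x,y)\tag{1}$$ has a non-degenerate center at the origin (a singular point with a punctured neighbourhood filled with periodic orbits surrounding it, and with invertible linear part), and such that $H\ge 0$ near the origin, so that the energies of the periodic orbits near the origin are the small $h>0$. For small $h>0$ let $\gamma_h$ be the periodic orbit of energy $h$ near the origin, that is, the part of $\{H=h\}$ in a suitable fixed neighbourhood of the origin; let $T(h)$ be its minimal period and $A(h)$ the area of the region that it encloses. For small $\rho>0$ let $\varpi(\rho)$ be the minimal period of the orbit starting at $(0,\rho)$. Then: (i) The functions $T$ and $A$ extend to functions that are analytic at $h=0$, and $A'(h)=T(h)$ in a neighbourhood of $h=0$. (ii) - The orbit starting at $(0,\rho)$ is periodic for small $\rho>0$, and $\varpi$ extends to a function that is analytic at $\rho=0$. Its Taylor series $\sum_n t_n\rho^n$ is obtained algorithmically from the expression of (1) in polar coordinates $x=r\cos\theta$, $y=r\sin\theta$, as follows. Expand in powers of $r$ $$\frac{dr}{d\theta}=\frac{\dot r}{\dot\theta}=\sum_{m\ge1}F_m(\theta)r^m,\qquad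 \frac{dt}{d\theta}=\frac1{\dot\theta}=\sum_{m\ge0}G_m(\theta)r^m .$$ Put $u_1(\theta)=\exp\int_{\pi/2}^{\theta}F_1(s)\,ds$ and, for $n\ge2$, successively $$u_n(\theta)=u_1(\theta)\int_{\pi/2}^{\theta}\frac1{u_1(s)}\,[\rho^n]\sum_{m=2}^{n}F_m(s)\Big(\sum_{j=1}^{n-1}u_j(s)\rho^j\Big)^m ds ,$$ where $[\rho^n]$ denotes the coefficient of $\rho^n$. Then, for all $n\ge0$, $$t_n=\int_{\pi/2}^{\pi/2+2\pi}[\rho^n]\sum_{m=0}^{n}G_m(\theta)\Big(\sum_{j=1}^{n}u_j(\theta)\rho^j\Big)^m d\theta .$$ - For small $h>0$ the equation $H(0,\rho)=h$ has a positive solution $\rho=S(\sqrt h)$ with $S$ analytic at zero. The Taylor series $S(z)=\sum_{n\ge1}s_nz^n$ is obtained algorithmically from the Taylor series $H(0,\rho)=\sum_{k\ge2}a_k\rho^k$: $s_1=1/\sqrt{a_2}$ and, for $n\ge2$, successively $$s_n=-\frac{1}{2a_2s_1}\,[z^{n+1}]\sum_{k=2}^{n+1}a_k\Big(\sum_{j=1}^{n-1}s_jz^j\Big)^k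 .$$ - For all small $h\ge0$ it holds that $T(h)=\varpi(S(\sqrt h))$ and $A(h)=\int_0^hT(s)\,ds$. -/

import Mathlib

open Real Set Filter Topology MeasureTheory

noncomputable section

/-- The Hamiltonian vector field `(-H_y, H_x)` of `H`. -/
def hamField (H : ℝ × ℝ → ℝ) (z : ℝ × ℝ) : ℝ × ℝ :=
  (-(fderiv ℝ H z (0, 1)), fderiv ℝ H z (1, 0))

/-- `γ` is a solution, defined for all times, of the Hamiltonian system
`x' = -H_y`, `y' = H_x`. -/
def IsSolution (H : ℝ × ℝ → ℝ) (γ : ℝ → ℝ × ℝ) : Prop :=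
  ∀ t : ℝ, HasDerivAt γ (hamField H (γ t)) t

/-- `γ` is a non-constant periodic solution and `τ` is its minimal period. -/
def IsPeriodicOrbit (H : ℝ × ℝ → ℝ) (γ : ℝ → ℝ × ℝ) (τ : ℝ) : Prop :=
  IsSolution H γ ∧ IsLeast {s : ℝ | 0 < s ∧ Function.Periodic γ s} τ

/-- The region enclosed by a planar set `C` (typically a closed curve): the union of the bounded
connected components of its complement. -/
def enclosed (C : Set (ℝ × ℝ)) : Set (ℝ × ℝ) :=
  {z | z ∉ C ∧ Bornology.IsBounded (connectedComponentIn Cᶜ z)}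

/-- The origin is a non-degenerate center of the Hamiltonian system: it is a singular point with a
punctured neighbourhood filled with periodic orbits surrounding it, and the linear part of the
system there is invertible (at a center of a Hamiltonian system this says that the eigenvalues
of the linear part are `±iω` with `ω ≠ 0`). -/
structure IsNondegenerateCenter (H : ℝ × ℝ → ℝ) : Prop where
  singular : hamField H 0 = 0
  center : ∀ᶠ p in 𝓝[≠] (0 : ℝ × ℝ), ∃ (γ : ℝ → ℝ × ℝ) (τ : ℝ),
    IsPeriodicOrbit H γ τ ∧ γ 0 = p ∧ (0 : ℝ × ℝ) ∈ enclosed (range γ)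
  nondegenerate : (fderiv ℝ (hamField H) 0).det ≠ 0

/-- `γ` parametrizes the part of the energy level `{H = h}` in `V`; it is a periodic
orbit surrounding the origin, with minimal period `τ`. -/
def IsEnergyOval (H : ℝ × ℝ → ℝ) (V : Set (ℝ × ℝ)) (h : ℝ) (γ : ℝ → ℝ × ℝ) (τ : ℝ) : Prop :=
  IsPeriodicOrbit H γ τ ∧ range γ = {z | z ∈ V ∧ H z = h} ∧ (0 : ℝ × ℝ) ∈ enclosed (range γ)

/-- `T` is, for small positive energies `h`, the period function of the center: `T h` is the
minimal period of the periodic orbit of energy `h` near the origin. -/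
def IsPeriodFunction (H : ℝ × ℝ → ℝ) (T : ℝ → ℝ) : Prop :=
  ∃ V ∈ 𝓝 (0 : ℝ × ℝ), ∃ h₁ > 0, ∀ h ∈ Ioo 0 h₁, ∃ γ : ℝ → ℝ × ℝ, IsEnergyOval H V h γ (T h)

/-- `A` is, for small positive energies `h`, the area function of the center: `A h` is the
area enclosed by the periodic orbit of energy `h` near the origin. -/
def IsAreaFunction (H : ℝ × ℝ → ℝ) (A : ℝ → ℝ) : Prop :=
  ∃ V ∈ 𝓝 (0 : ℝ × ℝ), ∃ h₁ > 0, ∀ h ∈ Ioo 0 h₁, ∃ (γ : ℝ → ℝ × ℝ) (τ : ℝ),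
    IsEnergyOval H V h γ τ ∧ A h = volume.real (enclosed (range γ))

/-- The `n`-th Taylor coefficient at `0` of a function of one real variable. -/
def taylorCoeff (f : ℝ → ℝ) (n : ℕ) : ℝ := iteratedDeriv n f 0 / (n.factorial : ℝ)

/-- The Hamiltonian system in polar coordinates `x = r cos θ`, `y = r sin θ`: the expansion in
powers of `r` of `r' = cos θ · x' + sin θ · y'`. -/
def polarRadial (H : ℝ × ℝ → ℝ) (θ : ℝ) : PowerSeries ℝ :=
  PowerSeries.mk (taylorCoeff fun r : ℝ =>
    cos θ * (hamField H (r * cos θ, r * sin θ)).1 + sin θ * (hamField H (r * cos θ, r * sin θ)).2)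

/-- The Hamiltonian system in polar coordinates `x = r cos θ`, `y = r sin θ`: the expansion in
powers of `r` of `θ' = (cos θ · y' - sin θ · x') / r` (the numerator vanishes at `r = 0`). -/
def polarAngular (H : ℝ × ℝ → ℝ) (θ : ℝ) : PowerSeries ℝ :=
  PowerSeries.mk fun n => taylorCoeff (fun r : ℝ =>
    cos θ * (hamField H (r * cos θ, r * sin θ)).2
      - sin θ * (hamField H (r * cos θ, r * sin θ)).1) (n + 1)

/-- The coefficients of the expansion `dr/dθ = ∑ Fₘ(θ) rᵐ` of the orbit equation. -/
def orbitSeries (H : ℝ × ℝ → ℝ) (θ : ℝ) : PowerSeries ℝ := polarRadial H θ * (polarAngular H θ)⁻¹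

/-- The coefficients of the expansion `dt/dθ = ∑ Gₘ(θ) rᵐ` of the time equation. -/
def timeSeries (H : ℝ × ℝ → ℝ) (θ : ℝ) : PowerSeries ℝ := (polarAngular H θ)⁻¹

/-- The coefficients `uₙ(θ)` of the solution `r(θ, ρ) = ∑ uₙ(θ) ρⁿ` of `dr/dθ = ∑ Fₘ(θ) rᵐ`
with `r(π/2, ρ) = ρ`, computed one after the other from the linear equations
`u₁' = F₁ u₁`, `u₁(π/2) = 1` and, for `n ≥ 2`,
`uₙ' = F₁ uₙ + [ρⁿ] ∑_{2 ≤ m ≤ n} Fₘ (u₁ρ + ⋯ + uₙ₋₁ρⁿ⁻¹)ᵐ`, `uₙ(π/2) = 0`. -/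
def solutionCoeff (F : ℝ → PowerSeries ℝ) : ℕ → ℝ → ℝ
  | 0 => fun _ => 0
  | 1 => fun θ => exp (∫ s in (π / 2)..θ, PowerSeries.coeff 1 (F s))
  | (n + 2) => fun θ =>
      exp (∫ s in (π / 2)..θ, PowerSeries.coeff 1 (F s)) *
        ∫ s in (π / 2)..θ,
          (exp (∫ s' in (π / 2)..s, PowerSeries.coeff 1 (F s')))⁻¹ *
            PowerSeries.coeff (n + 2)
              (∑ m ∈ Finset.Icc 2 (n + 2), PowerSeries.C (PowerSeries.coeff m (F s)) *
                (∑ j : Fin (n + 2),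
                  PowerSeries.C (solutionCoeff F j.1 s) * PowerSeries.X ^ j.1) ^ m)
  decreasing_by exact j.2

/-- The coefficients of the period `∑ tₙ ρⁿ` of the orbit through `(0, ρ)`, computed from the
polar form of the system: `tₙ = ∫ [ρⁿ] ∑_{m ≤ n} Gₘ(θ) (u₁(θ)ρ + ⋯ + uₙ(θ)ρⁿ)ᵐ dθ`, the integral
being over one turn starting at the angle `π/2`. -/
def periodCoeff (H : ℝ × ℝ → ℝ) (n : ℕ) : ℝ :=
  ∫ θ in (π / 2)..(π / 2 + 2 * π),
    PowerSeries.coeff n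
      (∑ m ∈ Finset.range (n + 1), PowerSeries.C (PowerSeries.coeff m (timeSeries H θ)) *
        (∑ j ∈ Finset.range (n + 1),
          PowerSeries.C (solutionCoeff (orbitSeries H) j θ) * PowerSeries.X ^ j) ^ m)

/-- The coefficients `sₙ` of the solution `ρ = ∑ sₙ zⁿ` of `∑_{k ≥ 2} aₖ ρᵏ = z²` with `s₁ > 0`,
computed one after the other by comparing the coefficients of `zⁿ⁺¹`:
`s₁ = 1 / √a₂` and, for `n ≥ 2`,
`2 a₂ s₁ sₙ + [zⁿ⁺¹] ∑_{2 ≤ k ≤ n + 1} aₖ (s₁z + ⋯ + sₙ₋₁zⁿ⁻¹)ᵏ = 0`. -/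
def levelCoeff (a : ℕ → ℝ) : ℕ → ℝ
  | 0 => 0
  | 1 => 1 / √(a 2)
  | (n + 2) =>
      -(PowerSeries.coeff (n + 3)
          (∑ k ∈ Finset.Icc 2 (n + 3), PowerSeries.C (a k) *
            (∑ j : Fin (n + 2), PowerSeries.C (levelCoeff a j.1) * PowerSeries.X ^ j.1) ^ k))
        / (2 * a 2 * (1 / √(a 2)))
  decreasing_by exact j.2

end

/-! ### Taylor coefficients of sums, products and compositions. -/

section TaylorSeries

/-! The proof works in the Banach algebra `ℝ →ᵇ ℝ` of bounded continuous functions of the angle θ,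
so that analyticity in the energy variable is uniform in θ and commutes with integration over θ.

Since H and dH vanish at the origin, H(r e_θ) = r² E(r, θ) and θ' is analytic up to r = 0. The sign
of H and the invertible linear part make E(0, ·) a positive definite quadratic form on the circle
(`exists_polarForm`). With r = zW, the equation H(r e_θ) = z² becomes W² E(zW) = 1, which the
analytic implicit function theorem solves in the algebra (`exists_implicit`). Thus the level curve
of energy z² is r = R(z, θ) with R analytic in z.

In polar coordinates ∂H/∂r = r θ' > 0. So each ray meets the curve once, the curve carries a
periodic orbit of period ∫ dθ/θ', and it encloses the area ½∫R² dθ. Uniqueness on rays also yields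
R(-z, θ) = -R(z, θ + π), so the area is even in z and is therefore an analytic function A of h = z².
Differentiating H(R e_θ) = z² in z gives R ∂R/∂z = 2z/θ'; integrated over θ this says 2z A'(z²) = 2z
∫ dθ/θ' (`exists_area`). Hence T = A', and the analyticity of T needs no separate argument.

For the series, S(z) = R(z, π/2) has a local inverse Z. The curves R(Z(ρ), ·) solve the integral
equation of dr/dθ starting at ρ; its Taylor coefficients in ρ satisfy linear equations solved by
variation of constants (`solutionCoeff_eq_of_integral_equation`, `taylorCoeff_period`). The
coefficients of S come from comparing coefficients in H(0, S(z)) = z² (`levelCoeff_eq_taylorCoeff`).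
-/

/-- The Taylor series at `0` of a function of one real variable. -/
noncomputable def taylorSeries (f : ℝ → ℝ) : PowerSeries ℝ := PowerSeries.mk (taylorCoeff f)

@[simp]
theorem coeff_taylorSeries (f : ℝ → ℝ) (n : ℕ) :
    PowerSeries.coeff n (taylorSeries f) = taylorCoeff f n := by
  simp [taylorSeries]

theorem taylorCoeff_congr {f g : ℝ → ℝ} (h : f =ᶠ[𝓝 0] g) : taylorCoeff f = taylorCoeff g := by
  funext n
  rw [taylorCoeff, taylorCoeff, h.iteratedDeriv_eq]

theorem taylorSeries_congr {f g : ℝ → ℝ} (h : f =ᶠ[𝓝 0] g) : taylorSeries f = taylorSeries g := by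
  rw [taylorSeries, taylorSeries, taylorCoeff_congr h]

@[simp]
theorem taylorCoeff_zero (f : ℝ → ℝ) : taylorCoeff f 0 = f 0 := by
  simp [taylorCoeff]

theorem taylorCoeff_one (f : ℝ → ℝ) : taylorCoeff f 1 = deriv f 0 := by
  simp [taylorCoeff]

theorem taylorCoeff_deriv (f : ℝ → ℝ) (n : ℕ) :
    taylorCoeff (deriv f) n = (n + 1) * taylorCoeff f (n + 1) := by
  rw [taylorCoeff, taylorCoeff, ← iteratedDeriv_succ', Nat.factorial_succ]
  have : (n.factorial : ℝ) ≠ 0 := by positivity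
  have : (n + 1 : ℝ) ≠ 0 := by positivity
  push_cast
  field_simp

theorem taylorSeries_mul {f g : ℝ → ℝ} (hf : AnalyticAt ℝ f 0) (hg : AnalyticAt ℝ g 0) :
    taylorSeries (fun x => f x * g x) = taylorSeries f * taylorSeries g := by
  ext n
  rw [coeff_taylorSeries, PowerSeries.coeff_mul, taylorCoeff,
    iteratedDeriv_fun_mul hf.contDiffAt hg.contDiffAt,
    Finset.Nat.sum_antidiagonal_eq_sum_range_succ
      (fun i j => PowerSeries.coeff i (taylorSeries f) * PowerSeries.coeff j (taylorSeries g)),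
    Finset.sum_div]
  refine Finset.sum_congr rfl fun i hi => ?_
  have hi' : i ≤ n := Nat.lt_succ_iff.mp (Finset.mem_range.mp hi)
  rw [coeff_taylorSeries, coeff_taylorSeries, taylorCoeff, taylorCoeff, Nat.cast_choose ℝ hi']
  have h1 : (n.factorial : ℝ) ≠ 0 := by positivity
  have h2 : (i.factorial : ℝ) ≠ 0 := by positivity
  have h3 : ((n - i).factorial : ℝ) ≠ 0 := by positivity
  field_simp

theorem taylorSeries_add {f g : ℝ → ℝ} (hf : AnalyticAt ℝ f 0) (hg : AnalyticAt ℝ g 0) :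
    taylorSeries (fun x => f x + g x) = taylorSeries f + taylorSeries g := by
  ext n
  rw [map_add, coeff_taylorSeries, coeff_taylorSeries, coeff_taylorSeries, taylorCoeff,
    iteratedDeriv_fun_add hf.contDiffAt hg.contDiffAt, add_div, taylorCoeff, taylorCoeff]

theorem taylorSeries_const (c : ℝ) : taylorSeries (fun _ => c) = PowerSeries.C c := by
  ext n
  rw [coeff_taylorSeries, taylorCoeff, iteratedDeriv_const, PowerSeries.coeff_C]
  split_ifs with h <;> simp [h]

theorem taylorSeries_id : taylorSeries (fun x => x) = PowerSeries.X := by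
  ext n
  rw [coeff_taylorSeries, taylorCoeff, iteratedDeriv_fun_id_zero, PowerSeries.coeff_X]
  split_ifs with h <;> simp [h]

theorem taylorSeries_pow {f : ℝ → ℝ} (hf : AnalyticAt ℝ f 0) (m : ℕ) :
    taylorSeries (fun x => f x ^ m) = taylorSeries f ^ m := by
  induction m with
  | zero => simpa using taylorSeries_const 1
  | succ m ih => simp_rw [pow_succ]; rw [taylorSeries_mul (by fun_prop) hf, ih]

theorem taylorSeries_sum {ι : Type*} (s : Finset ι) {f : ι → ℝ → ℝ}
    (hf : ∀ i, AnalyticAt ℝ (f i) 0) :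
    taylorSeries (fun x => ∑ i ∈ s, f i x) = ∑ i ∈ s, taylorSeries (f i) := by
  classical
  induction s using Finset.induction_on with
  | empty => simpa using taylorSeries_const 0
  | insert a s ha ih =>
    simp_rw [Finset.sum_insert ha]
    rw [taylorSeries_add (hf a) (Finset.analyticAt_fun_sum _ fun i _ => hf i), ih]

theorem taylorSeries_inv {f : ℝ → ℝ} (hf : AnalyticAt ℝ f 0) (h0 : f 0 ≠ 0) :
    taylorSeries (fun x => (f x)⁻¹) = (taylorSeries f)⁻¹ := by
  have hc : PowerSeries.constantCoeff (taylorSeries f) ≠ 0 := by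
    rwa [← PowerSeries.coeff_zero_eq_constantCoeff_apply, coeff_taylorSeries, taylorCoeff_zero]
  rw [PowerSeries.eq_inv_iff_mul_eq_one hc, ← taylorSeries_mul (f := fun x => (f x)⁻¹) (hf.inv h0) hf,
    ← map_one PowerSeries.C, ← taylorSeries_const]
  refine taylorSeries_congr ?_
  filter_upwards [hf.continuousAt.eventually_ne h0] with x hx
  exact inv_mul_cancel₀ hx

/-- Division with remainder: an analytic function is its Taylor polynomial plus a multiple of
a power of the variable. -/
theorem AnalyticAt.exists_eventuallyEq_taylor {f : ℝ → ℝ} (hf : AnalyticAt ℝ f 0) (n : ℕ) :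
    ∃ q : ℝ → ℝ, AnalyticAt ℝ q 0 ∧
      f =ᶠ[𝓝 0] fun x => ∑ m ∈ Finset.range n, taylorCoeff f m * x ^ m + x ^ n * q x := by
  induction n with
  | zero => exact ⟨f, hf, by simp⟩
  | succ n ih =>
    obtain ⟨q, hq, h⟩ := ih
    -- `dslope q 0` is the quotient (q(x) - q(0))/x with its singularity removed; it is the next
    -- remainder.
    have hq' : AnalyticAt ℝ (dslope q 0) 0 := by
      obtain ⟨p, hp⟩ := hq
      exact ⟨_, hp.has_fpower_series_dslope_fslope⟩
    have hsplit : ∀ x, q x = q 0 + x * dslope q 0 x := fun x => by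
      have := sub_smul_dslope q 0 x
      simp only [sub_zero, smul_eq_mul] at this
      linarith
    have hcoeff : taylorCoeff f n = q 0 := by
      rw [← coeff_taylorSeries, taylorSeries_congr h, taylorSeries_add
        (Finset.analyticAt_fun_sum _ fun i _ => by fun_prop) (by fun_prop),
        taylorSeries_mul (by fun_prop) hq, taylorSeries_sum _ (fun i => by fun_prop)]
      have h1 : ∀ m : ℕ, taylorSeries (fun x : ℝ => x ^ m) = PowerSeries.X ^ m := fun m => by
        rw [taylorSeries_pow (by fun_prop), taylorSeries_id]
      rw [map_add, map_sum, Finset.sum_eq_zero, h1]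
      · simp [PowerSeries.coeff_X_pow_mul']
      · intro m hm
        rw [taylorSeries_mul (by fun_prop) (by fun_prop), taylorSeries_const, h1,
          PowerSeries.coeff_C_mul, PowerSeries.coeff_X_pow, if_neg, mul_zero]
        exact (Finset.mem_range.mp hm).ne'
    refine ⟨dslope q 0, hq', ?_⟩
    filter_upwards [h] with x hx
    rw [hx, Finset.sum_range_succ, hcoeff, hsplit x]
    ring

theorem PowerSeries.coeff_eq_of_X_pow_dvd_sub {p q : PowerSeries ℝ} {n k : ℕ} (hk : n < k)
    (h : PowerSeries.X ^ k ∣ p - q) : PowerSeries.coeff n p = PowerSeries.coeff n q := by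
  have := PowerSeries.X_pow_dvd_iff.mp h n hk
  rwa [map_sub, sub_eq_zero] at this

/-- The Taylor coefficients of a composition. -/
theorem taylorCoeff_comp {f g : ℝ → ℝ} (hf : AnalyticAt ℝ f 0) (hg : AnalyticAt ℝ g 0)
    (hg0 : g 0 = 0) {n k : ℕ} (hk : n < k) :
    taylorCoeff (fun x => f (g x)) n = PowerSeries.coeff n
      (∑ m ∈ Finset.range k, PowerSeries.C (taylorCoeff f m) * taylorSeries g ^ m) := by
  obtain ⟨q, hq, h⟩ := hf.exists_eventuallyEq_taylor k
  have hlim : Tendsto g (𝓝 0) (𝓝 0) := by simpa [hg0] using hg.continuousAt.tendsto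
  have hqg : AnalyticAt ℝ (fun x => q (g x)) 0 := AnalyticAt.fun_comp (by rwa [hg0]) hg
  have hpow : ∀ m, AnalyticAt ℝ (fun x => g x ^ m) 0 := fun m => hg.pow m
  have hcomp : (fun x => f (g x)) =ᶠ[𝓝 0] fun x =>
      ∑ m ∈ Finset.range k, taylorCoeff f m * g x ^ m + g x ^ k * q (g x) := hlim.eventually h
  rw [← coeff_taylorSeries, taylorSeries_congr hcomp, taylorSeries_add
    (Finset.analyticAt_fun_sum _ fun i _ => by fun_prop) ((hpow k).fun_mul hqg),
    taylorSeries_mul (hpow k) hqg, taylorSeries_sum _ (fun i => by fun_prop),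
    taylorSeries_pow hg]
  refine PowerSeries.coeff_eq_of_X_pow_dvd_sub hk ?_
  -- As g(0) = 0, the remainder g^k · q(g) is divisible by X^k and cannot affect the coefficient of
  -- degree n < k.
  have hX : PowerSeries.X ∣ taylorSeries g := by
    rw [PowerSeries.X_dvd_iff, ← PowerSeries.coeff_zero_eq_constantCoeff_apply]
    simp [hg0]
  convert! (pow_dvd_pow_of_dvd hX k).mul_right (taylorSeries fun x => q (g x)) using 1
  rw [add_comm, add_sub_assoc, ← Finset.sum_sub_distrib, Finset.sum_eq_zero, add_zero]
  intro m _
  rw [taylorSeries_mul (by fun_prop) (hpow m), taylorSeries_const, taylorSeries_pow hg, sub_self]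

/-- The Taylor coefficients of a composition, by truncation of the inner series. -/
theorem taylorCoeff_comp_trunc {f g : ℝ → ℝ} (hf : AnalyticAt ℝ f 0) (hg : AnalyticAt ℝ g 0)
    (hg0 : g 0 = 0) (n : ℕ) :
    taylorCoeff (fun x => f (g x)) n = PowerSeries.coeff n
      (∑ m ∈ Finset.range (n + 1), PowerSeries.C (taylorCoeff f m) *
        (∑ j ∈ Finset.range (n + 1), PowerSeries.C (taylorCoeff g j) * PowerSeries.X ^ j) ^ m) := by
  rw [taylorCoeff_comp hf hg hg0 n.lt_succ_self, map_sum, map_sum]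
  refine Finset.sum_congr rfl fun m _ => ?_
  rw [PowerSeries.coeff_C_mul, PowerSeries.coeff_C_mul]
  congr 1
  refine PowerSeries.coeff_eq_of_X_pow_dvd_sub n.lt_succ_self ((PowerSeries.X_pow_dvd_iff.mpr
    fun k hk => ?_).trans (sub_dvd_pow_sub_pow _ _ m))
  rw [map_sub, map_sum, coeff_taylorSeries, sub_eq_zero]
  simp only [PowerSeries.coeff_C_mul, PowerSeries.coeff_X_pow]
  rw [Finset.sum_eq_single_of_mem k (Finset.mem_range.mpr hk)] <;> aesop

/-- For a series `p` without constant term, the coefficients of `p ^ (m + 1)` of degree less than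
`n + m` only involve the coefficients of `p` of degree less than `n`. -/
theorem coeff_pow_eq_coeff_trunc_pow {p : PowerSeries ℝ} (hp : PowerSeries.coeff 0 p = 0)
    {n k m : ℕ} (hn : 1 ≤ n) (hk : k < n + m) :
    PowerSeries.coeff k (p ^ (m + 1)) = PowerSeries.coeff k
      ((∑ j : Fin n, PowerSeries.C (PowerSeries.coeff j.1 p) * PowerSeries.X ^ j.1) ^ (m + 1)) := by
  set q : PowerSeries ℝ :=
    ∑ j : Fin n, PowerSeries.C (PowerSeries.coeff j.1 p) * PowerSeries.X ^ j.1 with hq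
  have hcoeff : ∀ k < n, PowerSeries.coeff k q = PowerSeries.coeff k p := fun k hk => by
    rw [hq, map_sum]
    simp only [PowerSeries.coeff_C_mul, PowerSeries.coeff_X_pow]
    rw [Finset.sum_eq_single (⟨k, hk⟩ : Fin n)]
    · simp
    · intro b _ hb
      rw [if_neg, mul_zero]
      rintro rfl
      exact hb rfl
    · simp
  have hpq : PowerSeries.X ^ n ∣ p - q := PowerSeries.X_pow_dvd_iff.mpr fun k hk => by
    rw [map_sub, hcoeff k hk, sub_self]
  have hXp : PowerSeries.X ∣ p := by
    rwa [PowerSeries.X_dvd_iff, ← PowerSeries.coeff_zero_eq_constantCoeff_apply]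
  have hXq : PowerSeries.X ∣ q := by
    rw [PowerSeries.X_dvd_iff, ← PowerSeries.coeff_zero_eq_constantCoeff_apply, hcoeff 0 (by omega), hp]
  -- In p^(m+1) - q^(m+1) = (p - q) ∑ p^i q^(m-i), the first factor contributes X^n and every term
  -- of the sum X^m.
  have key : PowerSeries.X ^ (n + m) ∣ p ^ (m + 1) - q ^ (m + 1) := by
    rw [← (Commute.all p q).mul_geom_sum₂, pow_add]
    refine mul_dvd_mul hpq (Finset.dvd_sum fun i hi => ?_)
    have : m = i + (m + 1 - 1 - i) := by have := Finset.mem_range.mp hi; omega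
    conv_lhs => rw [this, pow_add]
    exact mul_dvd_mul (pow_dvd_pow_of_dvd hXp _) (pow_dvd_pow_of_dvd hXq _)
  exact PowerSeries.coeff_eq_of_X_pow_dvd_sub hk key

/-- Two analytic functions that agree for small positive arguments agree near `0`. -/
theorem AnalyticAt.eventuallyEq_of_nhdsGT {E : Type*} [NormedAddCommGroup E] [NormedSpace ℝ E]
    {f g : ℝ → E} (hf : AnalyticAt ℝ f 0) (hg : AnalyticAt ℝ g 0) (h : ∀ᶠ x in 𝓝[>] 0, f x = g x) :
    f =ᶠ[𝓝 0] g :=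
  (hf.frequently_eq_iff_eventually_eq hg).mp
    (h.frequently.filter_mono (nhdsWithin_mono _ fun _ hx => ne_of_gt hx))

/-- Continuous linear functionals commute with Taylor coefficients. -/
theorem exists_taylorCoeff_clm {E : Type*} [NormedAddCommGroup E] [NormedSpace ℝ E]
    [CompleteSpace E] {f : ℝ → E} (hf : AnalyticAt ℝ f 0) (n : ℕ) :
    ∃ c : E, ∀ L : E →L[ℝ] ℝ, taylorCoeff (fun x => L (f x)) n = L c := by
  refine ⟨(n.factorial : ℝ)⁻¹ • iteratedDeriv n f 0, fun L => ?_⟩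
  have h := L.iteratedFDeriv_comp_left (hf.contDiffAt (n := n)) le_rfl
  rw [taylorCoeff, map_smul, smul_eq_mul, div_eq_inv_mul, iteratedDeriv, iteratedDeriv,
    show (fun x => L (f x)) = L ∘ f from rfl, h]
  rfl

end TaylorSeries

/-! ### The two recursions for the coefficients. -/

section Recursions

/-- Compare coefficients in G(S(z)) = z². In degree n + 1 the unknown sₙ (n ≥ 2) enters only through
a₂S², as 2a₂s₁sₙ. Degree 2 gives a₂s₁² = 1, and the sign of s₁ selects the positive root. -/
theorem levelCoeff_eq_taylorCoeff {G S : ℝ → ℝ} (hG : AnalyticAt ℝ G 0) (hS : AnalyticAt ℝ S 0)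
    (hS0 : S 0 = 0) (hS1 : 0 < taylorCoeff S 1) (hG0 : G 0 = 0) (hG1 : taylorCoeff G 1 = 0)
    (hGS : ∀ᶠ z in 𝓝 0, G (S z) = z ^ 2) (n : ℕ) :
    taylorCoeff S n = levelCoeff (taylorCoeff G) n := by
  set a := taylorCoeff G with ha
  set s := taylorCoeff S with hs
  have hs0 : s 0 = 0 := by rw [hs, taylorCoeff_zero, hS0]
  have ha0 : a 0 = 0 := by rw [ha, taylorCoeff_zero, hG0]
  -- Any range longer than n gives the same coefficient; n + 3 ensures that the terms m = 0, 1, 2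
  -- can always be split off.
  have hcoeff : ∀ n : ℕ, PowerSeries.coeff n (∑ m ∈ Finset.range (n + 3),
      PowerSeries.C (a m) * taylorSeries S ^ m) = if n = 2 then 1 else 0 := fun n => by
    rw [← taylorCoeff_comp hG hS hS0 (by omega), taylorCoeff_congr hGS, ← coeff_taylorSeries,
      taylorSeries_pow (by fun_prop), taylorSeries_id, PowerSeries.coeff_X_pow]
  have hsum : ∀ n : ℕ, ∑ m ∈ Finset.range (n + 3), PowerSeries.C (a m) * taylorSeries S ^ m =
      PowerSeries.C (a 2) * taylorSeries S ^ 2 +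
        ∑ m ∈ Finset.Icc 3 (n + 2), PowerSeries.C (a m) * taylorSeries S ^ m := fun n => by
    have hIcc : Finset.Icc 3 (n + 2) = Finset.Ico 3 (n + 3) := by ext; simp; omega
    rw [hIcc, Finset.range_eq_Ico, Finset.sum_eq_sum_Ico_succ_bot (by omega),
      Finset.sum_eq_sum_Ico_succ_bot (by omega), Finset.sum_eq_sum_Ico_succ_bot (by omega), ha0, hG1]
    simp
  have hX : PowerSeries.X ∣ taylorSeries S := by
    rw [PowerSeries.X_dvd_iff, ← PowerSeries.coeff_zero_eq_constantCoeff_apply]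
    simpa using hS0
  have h1 : a 2 * s 1 ^ 2 = 1 := by
    have h := hcoeff 2
    rw [hsum, map_add, map_sum, Finset.sum_eq_zero, PowerSeries.coeff_C_mul, pow_two,
      PowerSeries.coeff_mul, Finset.Nat.sum_antidiagonal_eq_sum_range_succ_mk] at h
    · simp only [Finset.sum_range_succ, Finset.sum_range_zero, coeff_taylorSeries] at h
      simp only [← hs, hs0] at h
      norm_num at h
      linarith
    · intro m hm
      rw [PowerSeries.coeff_C_mul, PowerSeries.X_pow_dvd_iff.mp (pow_dvd_pow_of_dvd hX m) 2, mul_zero]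
      simp at hm; omega
  have ha2 : 0 < a 2 := by
    by_contra h
    nlinarith [sq_nonneg (s 1)]
  have hs1 : s 1 = 1 / √(a 2) := by
    rw [eq_div_iff (Real.sqrt_pos.mpr ha2).ne', ← abs_of_pos hS1, ← Real.sqrt_sq_eq_abs,
      ← Real.sqrt_mul (sq_nonneg _), mul_comm, h1, Real.sqrt_one]
  induction n using Nat.strong_induction_on with
  | _ n ih =>
    match n, ih with
    | 0, _ => rw [hs0, levelCoeff]
    | 1, _ => rw [hs1, levelCoeff]
    | n + 2, ih =>
      rw [levelCoeff]
      have hq : ∑ j : Fin (n + 2), PowerSeries.C (levelCoeff a j.1) * PowerSeries.X ^ j.1 =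
          ∑ j : Fin (n + 2),
            PowerSeries.C (PowerSeries.coeff j.1 (taylorSeries S)) * PowerSeries.X ^ j.1 :=
        Finset.sum_congr rfl fun j _ => by rw [← ih j.1 j.2, coeff_taylorSeries]
      rw [hq]
      set q := ∑ j : Fin (n + 2),
        PowerSeries.C (PowerSeries.coeff j.1 (taylorSeries S)) * PowerSeries.X ^ j.1 with hq'
      have hcq : ∀ k, PowerSeries.coeff k q = if k < n + 2 then s k else 0 := fun k => by
        rw [hq', map_sum]
        simp only [PowerSeries.coeff_C_mul, PowerSeries.coeff_X_pow, coeff_taylorSeries]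
        split_ifs with hk
        · rw [Finset.sum_eq_single (⟨k, hk⟩ : Fin (n + 2))]
          · simp [hs]
          · intro b _ hb
            rw [if_neg, mul_zero]
            rintro rfl
            exact hb rfl
          · simp
        · refine Finset.sum_eq_zero fun j _ => ?_
          rw [if_neg (by have := j.2; omega), mul_zero]
      -- Modulo X^(n+3), S is q + s_(n+2) X^(n+2). Squaring gains one degree, because both factors
      -- of S² - r² = (S + r)(S - r) are divisible: the first by X, the second by X^(n+3).
      have hsq : PowerSeries.coeff (n + 3) (taylorSeries S ^ 2) =
          PowerSeries.coeff (n + 3) (q ^ 2) + 2 * s 1 * s (n + 2) := by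
        have hd : PowerSeries.X ^ (n + 3) ∣
            taylorSeries S - (q + PowerSeries.C (s (n + 2)) * PowerSeries.X ^ (n + 2)) := by
          refine PowerSeries.X_pow_dvd_iff.mpr fun k hk => ?_
          rw [map_sub, map_add, hcq, PowerSeries.coeff_C_mul, PowerSeries.coeff_X_pow,
            coeff_taylorSeries]
          by_cases h : k = n + 2
          · simp [h, hs]
          · have : k < n + 2 := by omega
            simp [h, this, hs]
        have hXq : PowerSeries.X ∣ q := by
          rw [PowerSeries.X_dvd_iff, ← PowerSeries.coeff_zero_eq_constantCoeff_apply, hcq]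
          simp [hs0]
        set r := q + PowerSeries.C (s (n + 2)) * PowerSeries.X ^ (n + 2) with hr
        have hXr : PowerSeries.X ∣ r :=
          dvd_add hXq ((dvd_pow_self _ (by omega)).mul_left _)
        have hdvd : PowerSeries.X ^ (n + 4) ∣ taylorSeries S ^ 2 - r ^ 2 := by
          rw [sq_sub_sq, pow_succ PowerSeries.X (n + 3), mul_comm (_ + _)]
          exact mul_dvd_mul hd (dvd_add hX hXr)
        rw [PowerSeries.coeff_eq_of_X_pow_dvd_sub (by omega) hdvd]
        have hexp : r ^ 2 = q ^ 2 + PowerSeries.C (2 * s (n + 2)) * (q * PowerSeries.X ^ (n + 2)) +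
            PowerSeries.C (s (n + 2) ^ 2) * PowerSeries.X ^ (2 * n + 4) := by
          simp only [hr, map_mul, map_pow, map_ofNat]
          ring
        rw [hexp, map_add, map_add, PowerSeries.coeff_C_mul, PowerSeries.coeff_C_mul,
          PowerSeries.coeff_mul_X_pow', if_pos (by omega), PowerSeries.coeff_X_pow,
          if_neg (by omega), show n + 3 - (n + 2) = 1 by omega, hcq, if_pos (by omega)]
        ring
      have hpow : ∀ m ∈ Finset.Icc 3 (n + 3), PowerSeries.coeff (n + 3)
          (PowerSeries.C (a m) * taylorSeries S ^ m) =
            PowerSeries.coeff (n + 3) (PowerSeries.C (a m) * q ^ m) := fun m hm => by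
        obtain ⟨l, rfl⟩ : ∃ l, m = l + 1 := ⟨m - 1, by simp at hm; omega⟩
        rw [PowerSeries.coeff_C_mul, PowerSeries.coeff_C_mul, coeff_pow_eq_coeff_trunc_pow
          (n := n + 2) (by simpa using hS0) (by omega) (by simp at hm; omega), ← hq']
      have h := hcoeff (n + 3)
      -- The surplus powers m = n + 4 and n + 5 have order greater than n + 3 and drop out.
      have hIcc : Finset.Icc 3 (n + 3 + 2) = Finset.Icc 3 (n + 3) ∪ {n + 4, n + 5} := by
        ext; simp; omega
      have hIcc' : Finset.Icc 2 (n + 3) = insert 2 (Finset.Icc 3 (n + 3)) := by ext; simp; omega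
      rw [hsum, map_add, map_sum, hIcc, Finset.sum_union (by
        rw [Finset.disjoint_left]; intro x hx; simp at hx ⊢; omega), Finset.sum_congr rfl hpow,
        PowerSeries.coeff_C_mul, hsq, if_neg (by omega), Finset.sum_eq_zero (s := {n + 4, n + 5})] at h
      · rw [hIcc', Finset.sum_insert (by simp), map_add, map_sum, PowerSeries.coeff_C_mul, ← hs1,
          eq_div_iff (by positivity)]
        linarith
      · intro m hm
        rw [PowerSeries.coeff_C_mul, PowerSeries.X_pow_dvd_iff.mp (pow_dvd_pow_of_dvd hX m), mul_zero]
        simp at hm; omega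

/-- Variation of constants for a scalar linear equation. -/
theorem eq_exp_mul_of_linear_integral {a g u : ℝ → ℝ} (ha : Continuous a) (hg : Continuous g)
    (hu : Continuous u) {θ₀ c : ℝ} (h : ∀ θ, u θ = c + ∫ s in θ₀..θ, (a s * u s + g s)) (θ : ℝ) :
    u θ = exp (∫ s in θ₀..θ, a s) *
      (c + ∫ s in θ₀..θ, (exp (∫ s' in θ₀..s, a s'))⁻¹ * g s) := by
  have hA : ∀ x, HasDerivAt (fun θ => ∫ s in θ₀..θ, a s) (a x) x := fun x =>
    ha.integral_hasStrictDerivAt θ₀ x |>.hasDerivAt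
  have hE : Continuous fun s => (exp (∫ s' in θ₀..s, a s'))⁻¹ := by
    refine Continuous.inv₀ (continuous_exp.comp ?_) fun x => (exp_pos _).ne'
    exact continuous_iff_continuousAt.mpr fun x => (hA x).continuousAt
  have hB : ∀ x, HasDerivAt (fun θ => ∫ s in θ₀..θ, (exp (∫ s' in θ₀..s, a s'))⁻¹ * g s)
      ((exp (∫ s' in θ₀..x, a s'))⁻¹ * g x) x := fun x =>
    (hE.mul hg).integral_hasStrictDerivAt θ₀ x |>.hasDerivAt
  have hu' : ∀ x, HasDerivAt u (a x * u x + g x) x := fun x => by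
    have : HasDerivAt (fun θ => c + ∫ s in θ₀..θ, (a s * u s + g s)) (a x * u x + g x) x :=
      (((ha.mul hu).add hg).integral_hasStrictDerivAt θ₀ x).hasDerivAt.const_add c
    exact this.congr_of_eventuallyEq (Eventually.of_forall h)
  have hD : ∀ x, HasDerivAt (fun θ => u θ * exp (-∫ s in θ₀..θ, a s) -
      ∫ s in θ₀..θ, (exp (∫ s' in θ₀..s, a s'))⁻¹ * g s) 0 x := fun x => by
    convert! ((hu' x).mul (hA x).neg.exp).sub (hB x) using 1
    rw [← Real.exp_neg]
    simp only [Pi.neg_apply]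
    ring
  have hconst := is_const_of_deriv_eq_zero (fun x => (hD x).differentiableAt)
    (fun x => (hD x).deriv) θ θ₀
  simp only [intervalIntegral.integral_same, neg_zero, exp_zero, mul_one, sub_zero, h θ₀,
    add_zero] at hconst
  rw [← hconst, Real.exp_neg]
  have := (exp_pos (∫ s in θ₀..θ, a s)).ne'
  field_simp
  ring

/-- Since F₀ = 0 and u₀ = 0, in degree n the function uₙ appears only in the term m = 1, linearly
with coefficient F₁; the powers m ≥ 2 see only the earlier uⱼ. Each equation is thus a scalar linear
one, with initial value 1 for n = 1 and 0 otherwise. -/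
theorem solutionCoeff_eq_of_integral_equation {F : ℝ → PowerSeries ℝ} {u : ℕ → ℝ → ℝ}
    (hF0 : ∀ s, PowerSeries.coeff 0 (F s) = 0)
    (hF1 : Continuous fun s => PowerSeries.coeff 1 (F s))
    (hu0 : ∀ s, u 0 s = 0) (hu : ∀ n, Continuous (u n))
    (hint : ∀ n, Continuous fun s => PowerSeries.coeff n (∑ m ∈ Finset.range (n + 1),
      PowerSeries.C (PowerSeries.coeff m (F s)) * PowerSeries.mk (fun j => u j s) ^ m))
    (heq : ∀ n θ, u n θ = (if n = 1 then 1 else 0) +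
      ∫ s in (π / 2)..θ, PowerSeries.coeff n (∑ m ∈ Finset.range (n + 1),
        PowerSeries.C (PowerSeries.coeff m (F s)) * PowerSeries.mk (fun j => u j s) ^ m))
    (n : ℕ) (θ : ℝ) : solutionCoeff F n θ = u n θ := by
  induction n using Nat.strong_induction_on generalizing θ with
  | _ n ih =>
    match n, ih with
    | 0, _ => rw [hu0, solutionCoeff]
    | 1, _ =>
      have h1 : ∀ s, PowerSeries.coeff 1 (∑ m ∈ Finset.range (1 + 1),
          PowerSeries.C (PowerSeries.coeff m (F s)) * PowerSeries.mk (fun j => u j s) ^ m) =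
            PowerSeries.coeff 1 (F s) * u 1 s + 0 := fun s => by
        rw [Finset.sum_range_succ, Finset.sum_range_one, hF0, pow_one, map_add,
          PowerSeries.coeff_C_mul 1, PowerSeries.coeff_C_mul, PowerSeries.coeff_mk]
        simp
      have := eq_exp_mul_of_linear_integral (c := 1) hF1 continuous_const (hu 1)
        (θ₀ := π / 2) (fun θ => by
          rw [heq 1 θ, if_pos rfl]; exact congrArg _ (intervalIntegral.integral_congr fun s _ => h1 s)) θ
      rw [this, solutionCoeff]
      simp
    | n + 2, ih =>
      have hsplit : ∀ s, PowerSeries.coeff (n + 2) (∑ m ∈ Finset.range (n + 2 + 1),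
          PowerSeries.C (PowerSeries.coeff m (F s)) * PowerSeries.mk (fun j => u j s) ^ m) =
            PowerSeries.coeff 1 (F s) * u (n + 2) s + PowerSeries.coeff (n + 2)
              (∑ m ∈ Finset.Icc 2 (n + 2), PowerSeries.C (PowerSeries.coeff m (F s)) *
                (∑ j : Fin (n + 2),
                  PowerSeries.C (solutionCoeff F j.1 s) * PowerSeries.X ^ j.1) ^ m) := fun s => by
        have hIcc : Finset.Icc 2 (n + 2) = Finset.Ico 2 (n + 2 + 1) := by ext; simp
        rw [hIcc, Finset.range_eq_Ico, Finset.sum_eq_sum_Ico_succ_bot (by omega),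
          Finset.sum_eq_sum_Ico_succ_bot (by omega), hF0, map_add, map_add, zero_add, pow_one,
          PowerSeries.coeff_C_mul, PowerSeries.coeff_C_mul, PowerSeries.coeff_mk, map_sum, map_sum]
        simp only [pow_zero, zero_add, zero_mul]
        congr 1
        refine Finset.sum_congr rfl fun m hm => ?_
        obtain ⟨l, rfl⟩ : ∃ l, m = l + 1 := ⟨m - 1, by simp at hm; omega⟩
        rw [PowerSeries.coeff_C_mul, PowerSeries.coeff_C_mul, coeff_pow_eq_coeff_trunc_pow
          (n := n + 2) (by simp [hu0]) (by omega) (by simp at hm; omega)]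
        simp_rw [PowerSeries.coeff_mk, fun j : Fin (n + 2) => ih j.1 j.2]
      have hg : Continuous fun s => PowerSeries.coeff (n + 2)
              (∑ m ∈ Finset.Icc 2 (n + 2), PowerSeries.C (PowerSeries.coeff m (F s)) *
                (∑ j : Fin (n + 2),
                  PowerSeries.C (solutionCoeff F j.1 s) * PowerSeries.X ^ j.1) ^ m) := by
        convert! (hint (n + 2)).sub (hF1.mul (hu (n + 2))) using 2 with s
        simp only [Pi.sub_apply, Pi.mul_apply]
        rw [hsplit s]
        ring
      have := eq_exp_mul_of_linear_integral (c := 0) hF1 hg (hu (n + 2))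
        (θ₀ := π / 2) (fun θ => by
          rw [heq (n + 2) θ, if_neg (by omega)]
          exact congrArg _ (intervalIntegral.integral_congr fun s _ => hsplit s)) θ
      rw [this, solutionCoeff, zero_add]

end Recursions

/-! ### Power series with coefficients in a commutative Banach algebra. -/

section PowerSums

variable {B : Type*} [NormedCommRing B] [NormedAlgebra ℝ B] [CompleteSpace B] [NormOneClass B]

/-- The bound on the coefficients makes the radius of convergence at least a. It is applied with B =
ℝ for functions of z², and with B = `ℝ →ᵇ ℝ` for superposition operators. -/
theorem analyticAt_tsum_mul_pow {c : ℕ → B} {C a : ℝ} (ha : 0 < a)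
    (h : ∀ n, ‖c n‖ * a ^ n ≤ C) :
    AnalyticAt ℝ (fun x : B => ∑' n, c n * x ^ n) 0 ∧
      ∀ x : B, ‖x‖ < a → HasSum (fun n => c n * x ^ n) (∑' n, c n * x ^ n) := by
  set p : FormalMultilinearSeries ℝ B B := fun n =>
    (ContinuousLinearMap.mul ℝ B (c n)).compContinuousMultilinearMap
      (ContinuousMultilinearMap.mkPiAlgebraFin ℝ n B) with hp
  lift a to NNReal using ha.le
  have happ : ∀ n (x : B), p n (fun _ => x) = c n * x ^ n := fun n x => by simp [hp]
  have hnorm : ∀ n, ‖p n‖ ≤ ‖c n‖ := fun n => by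
    refine (ContinuousLinearMap.norm_compContinuousMultilinearMap_le _ _).trans ?_
    rw [ContinuousMultilinearMap.norm_mkPiAlgebraFin, mul_one]
    exact ContinuousLinearMap.opNorm_mul_apply_le ℝ B (c n)
  have hr : (a : ENNReal) ≤ p.radius := p.le_radius_of_bound C fun n =>
    (mul_le_mul_of_nonneg_right (hnorm n) (by positivity)).trans (h n)
  have hpos : 0 < p.radius := lt_of_lt_of_le (by exact_mod_cast ha) hr
  have hball := p.hasFPowerSeriesOnBall hpos
  have hsum : p.sum = fun x : B => ∑' n, c n * x ^ n := by
    funext x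
    simp only [FormalMultilinearSeries.sum, happ]
  rw [hsum] at hball
  refine ⟨hball.analyticAt, fun x hx => ?_⟩
  have := hball.hasSum (y := x) (by
    rw [Metric.mem_eball, edist_zero_right]
    refine lt_of_lt_of_le ?_ hr
    rw [enorm_eq_nnnorm]
    exact_mod_cast hx)
  simpa [happ] using this

/-- An even analytic function is an analytic function of the square. -/
theorem AnalyticAt.exists_eq_comp_sq {f : ℝ → ℝ} (hf : AnalyticAt ℝ f 0)
    (heven : ∀ᶠ z in 𝓝 0, f (-z) = f z) :
    ∃ g : ℝ → ℝ, AnalyticAt ℝ g 0 ∧ ∀ᶠ z in 𝓝 0, f z = g (z ^ 2) := by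
  obtain ⟨p, hp⟩ := hf
  obtain ⟨r, hball⟩ := hp
  obtain ⟨a, ha, har⟩ := ENNReal.lt_iff_exists_nnreal_btwn.mp hball.r_pos
  have ha' : (0 : ℝ) < a := by exact_mod_cast ha
  obtain ⟨C, hC, hbound⟩ := p.norm_le_div_pow_of_pos_of_lt_radius (by exact_mod_cast ha)
    (lt_of_lt_of_le har hball.r_le)
  have hg := analyticAt_tsum_mul_pow (B := ℝ) (c := fun n => p.coeff (2 * n)) (C := C)
    (a := (a : ℝ) ^ 2) (by positivity) fun n => by
      have h1 : ‖p.coeff (2 * n)‖ ≤ C / a ^ (2 * n) := by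
        refine le_trans ?_ (hbound (2 * n))
        exact (p.norm_apply_eq_norm_coef).symm ▸ le_rfl
      rw [← pow_mul]
      exact (le_div_iff₀ (by positivity)).mp h1
  refine ⟨_, hg.1, ?_⟩
  filter_upwards [heven, Metric.ball_mem_nhds (0 : ℝ) ha'] with z hz hza
  rw [mem_ball_zero_iff] at hza
  have hsum : ∀ y : ℝ, ‖y‖ < a → HasSum (fun n => p.coeff n * y ^ n) (f y) := fun y hy => by
    have := hball.hasSum (y := y) (by
      rw [Metric.mem_eball, edist_zero_right]
      refine lt_trans ?_ har
      rw [enorm_eq_nnnorm]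
      exact_mod_cast hy)
    simpa [mul_comm] using this
  -- Averaging the expansions at z and -z cancels the odd powers.
  have h1 := ((hsum z hza).add (hsum (-z) (by rwa [norm_neg]))).div_const 2
  rw [hz, add_self_div_two] at h1
  have hinj : Function.Injective fun n : ℕ => 2 * n := fun x y h => by simpa using h
  rw [← hinj.hasSum_iff] at h1
  · refine (h1.congr_fun ?_).unique (hg.2 (z ^ 2) ?_)
    · intro n
      simp only [Function.comp, pow_mul, neg_sq]
      ring
    · rw [norm_pow]; gcongr
  · intro n hn
    have : Odd n := by
      rw [← Nat.not_even_iff_odd]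
      rintro ⟨k, rfl⟩
      exact hn ⟨k, by simp; ring⟩
    rw [this.neg_pow]
    ring

end PowerSums

/-! ### Superposition operators on functions of the angle. -/

section Superposition

open BoundedContinuousFunction

/-- The unit vector of polar angle `θ`. -/
noncomputable def unitVec (θ : ℝ) : ℝ × ℝ := (cos θ, sin θ)

theorem norm_unitVec_le (θ : ℝ) : ‖unitVec θ‖ ≤ 1 := by
  simp [unitVec, Prod.norm_def, abs_cos_le_one, abs_sin_le_one]

theorem continuous_unitVec : Continuous unitVec :=
  continuous_cos.prodMk continuous_sin

theorem smul_unitVec (r θ : ℝ) : r • unitVec θ = (r * cos θ, r * sin θ) := rfl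

/-- Superposition operators along rays: for `g` analytic at the origin of the plane, the map
`R ↦ (θ ↦ g (R(θ) e_θ))` is analytic on bounded continuous functions, and so are its successive
quotients by `R`. -/
theorem exists_superposition {g : ℝ × ℝ → ℝ} (hg : AnalyticAt ℝ g 0) :
    ∃ N : ℕ → (ℝ →ᵇ ℝ) → (ℝ →ᵇ ℝ), (∀ k, AnalyticAt ℝ (N k) 0) ∧
      (∀ θ, N 0 0 θ = g 0) ∧ (∀ θ, N 1 0 θ = fderiv ℝ g 0 (unitVec θ)) ∧
      ∃ δ > 0, ∀ R : ℝ →ᵇ ℝ, ‖R‖ < δ →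
        (∀ θ, N 0 R θ = g (R θ • unitVec θ)) ∧ ∀ k, N k R = N k 0 + R * N (k + 1) R := by
  obtain ⟨p, r, hball⟩ := hg
  obtain ⟨a, ha, har⟩ := ENNReal.lt_iff_exists_nnreal_btwn.mp hball.r_pos
  have ha' : (0 : ℝ) < a := by exact_mod_cast ha
  obtain ⟨C, hC, hbound⟩ := p.norm_le_div_pow_of_pos_of_lt_radius (by exact_mod_cast ha)
    (lt_of_lt_of_le har hball.r_le)
  have hc : ∀ n θ, ‖p n fun _ => unitVec θ‖ ≤ C / a ^ n := fun n θ => by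
    refine ((p n).le_opNorm _).trans ((mul_le_of_le_one_right (norm_nonneg _) ?_).trans (hbound n))
    exact Finset.prod_le_one (fun _ _ => norm_nonneg _) fun _ _ => norm_unitVec_le θ
  -- `c n` is the homogeneous part of degree n of g restricted to the unit circle. Thus g(R e_θ) = ∑
  -- cₙ Rⁿ in the algebra, and `N k` is the shifted series ∑ c_(n+k) Rⁿ.
  set c : ℕ → (ℝ →ᵇ ℝ) := fun n => BoundedContinuousFunction.ofNormedAddCommGroup
    (fun θ => p n fun _ => unitVec θ)
    ((p n).cont.comp (continuous_pi fun _ => continuous_unitVec)) _ (hc n) with hcdef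
  have hcn : ∀ n, ‖c n‖ ≤ C / a ^ n := fun n =>
    BoundedContinuousFunction.norm_ofNormedAddCommGroup_le _ (by positivity) _
  have hN : ∀ k, _ := fun k => analyticAt_tsum_mul_pow (c := fun n => c (n + k))
    (C := C / a ^ k) ha' fun n => by
      rw [← le_div_iff₀ (by positivity), div_div, ← pow_add, add_comm k n]
      exact hcn _
  have hN0 : ∀ k, ∑' n, c (n + k) * (0 : ℝ →ᵇ ℝ) ^ n = c k := fun k => by
    rw [tsum_eq_single 0 (fun n hn => by rw [zero_pow hn, mul_zero])]
    simp
  refine ⟨fun k R => ∑' n, c (n + k) * R ^ n, fun k => (hN k).1, fun θ => ?_, fun θ => ?_, a, ha',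
    fun R hR => ⟨fun θ => ?_, fun k => ?_⟩⟩
  · beta_reduce
    rw [hN0]
    exact hball.coeff_zero _
  · beta_reduce
    rw [hN0, hball.hasFPowerSeriesAt.fderiv_eq]
    rfl
  · have h1 := ((hN 0).2 R hR).mapL (BoundedContinuousFunction.evalCLM ℝ θ)
    have hy : ‖R θ • unitVec θ‖ < a := by
      rw [norm_smul]
      calc ‖R θ‖ * ‖unitVec θ‖ ≤ ‖R θ‖ * 1 := by gcongr; exact norm_unitVec_le θ
        _ ≤ ‖R‖ := by rw [mul_one]; exact R.norm_coe_le_norm θ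
        _ < a := hR
    have h2 := hball.hasSum (y := R θ • unitVec θ) (by
      rw [Metric.mem_eball, edist_zero_right]
      refine lt_trans ?_ har
      rw [enorm_eq_nnnorm]
      exact_mod_cast hy)
    rw [zero_add] at h2
    refine h1.unique (h2.congr_fun fun n => ?_)
    rw [(p n).map_smul_univ]
    simp [hcdef, mul_comm]
  · beta_reduce
    rw [hN0]
    have h1 := (hN k).2 R hR
    have h2 := ((hN (k + 1)).2 R hR).mul_left R
    rw [← hasSum_nat_add_iff' 1] at h1
    have := h1.unique (h2.congr_fun fun n => ?_)
    · rw [← this]; simp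
    · simp only [pow_succ]
      rw [show n + 1 + k = n + (k + 1) by ring]
      ring

end Superposition

/-! ### The Hamiltonian system in polar coordinates. -/

section PolarForm

open BoundedContinuousFunction

theorem AnalyticAt.eval_apply {E : Type*} [NormedAddCommGroup E] [NormedSpace ℝ E]
    {F : E → (ℝ →ᵇ ℝ)} {x : E} (hF : AnalyticAt ℝ F x) (θ : ℝ) :
    AnalyticAt ℝ (fun r => F r θ) x :=
  ((BoundedContinuousFunction.evalCLM ℝ θ : (ℝ →ᵇ ℝ) →L[ℝ] ℝ).analyticAt _).comp hF

/-- The radial component of the Hamiltonian vector field at the point with polar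
coordinates `(r, θ)`. -/
noncomputable def radialComp (H : ℝ × ℝ → ℝ) (r θ : ℝ) : ℝ :=
  cos θ * (hamField H (r • unitVec θ)).1 + sin θ * (hamField H (r • unitVec θ)).2

/-- The angular component of the Hamiltonian vector field at the point with polar
coordinates `(r, θ)`. -/
noncomputable def angularComp (H : ℝ × ℝ → ℝ) (r θ : ℝ) : ℝ :=
  cos θ * (hamField H (r • unitVec θ)).2 - sin θ * (hamField H (r • unitVec θ)).1

/-- A Hamiltonian system near a non-degenerate minimum at the origin, in polar form. The system is
described by superposition operators acting on bounded continuous functions of the angle: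
`radial R` is `r'`, `angular R` is `θ'` and `R ^ 2 * energy R` is the energy along `r = R(θ)`. -/
structure PolarForm (H : ℝ × ℝ → ℝ) where
  radial : (ℝ →ᵇ ℝ) → (ℝ →ᵇ ℝ)
  angular : (ℝ →ᵇ ℝ) → (ℝ →ᵇ ℝ)
  energy : (ℝ →ᵇ ℝ) → (ℝ →ᵇ ℝ)
  δ : ℝ
  κ : ℝ
  δ_pos : 0 < δ
  κ_pos : 0 < κ
  analyticAt_radial : AnalyticAt ℝ radial 0
  analyticAt_angular : AnalyticAt ℝ angular 0
  analyticAt_energy : AnalyticAt ℝ energy 0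
  analyticAt : ∀ z : ℝ × ℝ, ‖z‖ < δ → AnalyticAt ℝ H z
  radial_apply : ∀ R : ℝ →ᵇ ℝ, ‖R‖ < δ → ∀ θ, radial R θ = radialComp H (R θ) θ
  mul_angular_apply : ∀ R : ℝ →ᵇ ℝ, ‖R‖ < δ → ∀ θ, R θ * angular R θ = angularComp H (R θ) θ
  sq_mul_energy_apply : ∀ R : ℝ →ᵇ ℝ, ‖R‖ < δ → ∀ θ,
    R θ ^ 2 * energy R θ = H (R θ • unitVec θ)
  le_angular : ∀ R : ℝ →ᵇ ℝ, ‖R‖ < δ → ∀ θ, κ ≤ angular R θ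
  le_energy : ∀ R : ℝ →ᵇ ℝ, ‖R‖ < δ → ∀ θ, κ ≤ energy R θ

theorem exists_eq_smul_unitVec (p : ℝ × ℝ) :
    ∃ r θ : ℝ, 0 ≤ r ∧ θ ∈ Icc (-π) π ∧ p = r • unitVec θ := by
  refine ⟨‖(⟨p.1, p.2⟩ : ℂ)‖, Complex.arg ⟨p.1, p.2⟩, norm_nonneg _,
    ⟨(Complex.neg_pi_lt_arg _).le, Complex.arg_le_pi _⟩, ?_⟩
  rw [smul_unitVec, Complex.norm_mul_cos_arg, Complex.norm_mul_sin_arg]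

/-- Hamilton's equations in polar coordinates: ∂H/∂r = r θ' and ∂H/∂θ = -r r'. The identity for
∂H/∂r is what links energy, period and area. -/
theorem hasFDerivAt_polar {H : ℝ × ℝ → ℝ} {r θ : ℝ} (h : DifferentiableAt ℝ H (r • unitVec θ)) :
    HasFDerivAt (fun p : ℝ × ℝ => H (p.1 • unitVec p.2))
      (angularComp H r θ • ContinuousLinearMap.fst ℝ ℝ ℝ
        - (r * radialComp H r θ) • ContinuousLinearMap.snd ℝ ℝ ℝ) (r, θ) := by
  have h1 := h.hasFDerivAt.comp (r, θ) (hasFDerivAt_polarCoord_symm (r, θ))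
  convert! h1 using 1
  have hlin : ∀ a b : ℝ, fderiv ℝ H (r • unitVec θ) (a, b) =
      a * fderiv ℝ H (r • unitVec θ) (1, 0) + b * fderiv ℝ H (r • unitVec θ) (0, 1) := fun a b => by
    rw [← smul_eq_mul, ← smul_eq_mul, ← map_smul, ← map_smul, ← map_add]
    simp
  have happ : ∀ q : ℝ × ℝ, fderivPolarCoordSymm (r, θ) q =
      (cos θ * q.1 + -r * sin θ * q.2, sin θ * q.1 + r * cos θ * q.2) := fun q => by
    rw [fderivPolarCoordSymm, Matrix.toLin_finTwoProd_toContinuousLinearMap]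
    simp
  refine ContinuousLinearMap.ext fun q => ?_
  rw [ContinuousLinearMap.comp_apply, happ]
  change _ = fderiv ℝ H (r • unitVec θ) _
  rw [hlin]
  simp only [angularComp, radialComp, hamField, _root_.sub_apply,
    _root_.smul_apply, ContinuousLinearMap.coe_fst', ContinuousLinearMap.coe_snd',
    smul_eq_mul]
  ring

theorem hasDerivAt_ray {H : ℝ × ℝ → ℝ} {r θ : ℝ} (h : DifferentiableAt ℝ H (r • unitVec θ)) :
    HasDerivAt (fun r => H (r • unitVec θ)) (angularComp H r θ) r := by
  have := (hasFDerivAt_polar h).comp_hasDerivAt r ((hasDerivAt_id r).prodMk (hasDerivAt_const r θ))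
  simpa [Function.comp_def] using this

/-- A quadratic form that is non-negative on the unit circle and has non-zero discriminant is
bounded below by a positive constant there. -/
theorem exists_pos_le_quadratic {a b d : ℝ}
    (hq : ∀ θ, 0 ≤ a * cos θ ^ 2 + 2 * b * (sin θ * cos θ) + d * sin θ ^ 2)
    (hdet : a * d - b ^ 2 ≠ 0) :
    ∃ c > 0, ∀ θ, c ≤ a * cos θ ^ 2 + 2 * b * (sin θ * cos θ) + d * sin θ ^ 2 := by
  have hQ : ∀ x y : ℝ, 0 ≤ a * x ^ 2 + 2 * b * (y * x) + d * y ^ 2 := fun x y => by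
    obtain ⟨r, θ, _, _, h⟩ := exists_eq_smul_unitVec (x, y)
    rw [smul_unitVec, Prod.mk.injEq] at h
    rw [h.1, h.2]
    have := mul_nonneg (sq_nonneg r) (hq θ)
    nlinarith
  have ha : 0 < a := by
    refine lt_of_le_of_ne (by simpa using hQ 1 0) fun h => ?_
    have hb : b = 0 := by
      by_contra hb
      have := hQ (-(d + 1) / (2 * b)) 1
      have hx : 2 * b * (1 * (-(d + 1) / (2 * b))) = -(d + 1) := by field_simp
      rw [← h, hx] at this
      linarith
    simp [← h, hb] at hdet
  have hD : 0 < a * d - b ^ 2 := by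
    refine lt_of_le_of_ne ?_ hdet.symm
    have := hQ (-b) a
    have h2 : 0 ≤ a * (a * d - b ^ 2) := by nlinarith
    exact nonneg_of_mul_nonneg_right h2 ha
  have hd : 0 < d := by
    by_contra hd
    nlinarith [mul_nonneg ha.le (not_lt.mp hd |> neg_nonneg.mpr), sq_nonneg b]
  have htr : 0 < a + d := by linarith
  -- Determinant over trace is smaller than both eigenvalues. Subtracting l from both diagonal
  -- entries leaves a form of determinant exactly l², so completing the square gives the sum of two
  -- squares below.
  set l := (a * d - b ^ 2) / (a + d) with hl
  have hl0 : 0 < l := by positivity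
  have hleq : l * (a + d) = a * d - b ^ 2 := by rw [hl]; field_simp
  have hal : 0 < a - l := by
    have : 0 < (a - l) * (a + d) := by nlinarith [sq_nonneg b, mul_pos ha ha]
    exact pos_of_mul_pos_left this htr.le
  refine ⟨l, hl0, fun θ => ?_⟩
  have h1 := sin_sq_add_cos_sq θ
  have h2 : 0 ≤ (a - l) * (a * cos θ ^ 2 + 2 * b * (sin θ * cos θ) + d * sin θ ^ 2 - l) := by
    have : (a - l) * (a * cos θ ^ 2 + 2 * b * (sin θ * cos θ) + d * sin θ ^ 2 - l) =
        ((a - l) * cos θ + b * sin θ) ^ 2 + (l * sin θ) ^ 2 := by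
      linear_combination (sin θ ^ 2) * hleq * (-1) + (a - l) * l * h1
    rw [this]; positivity
  have := nonneg_of_mul_nonneg_right h2 hal
  linarith

theorem IsNondegenerateCenter.fderiv_eq_zero {H : ℝ × ℝ → ℝ} (hc : IsNondegenerateCenter H) :
    fderiv ℝ H 0 = 0 := by
  have h := hc.singular
  simp only [hamField, Prod.mk_eq_zero, neg_eq_zero] at h
  ext <;> simp [h.1, h.2]

/-- The vanishing of H, dH and the field at the origin permits division by R² and R respectively. At
R = 0, θ' is the quadratic form of the Hessian; it is non-negative because H is, and its
discriminant is the determinant of the linear part, so it is definite. Continuity of the operators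
then keeps θ' and E bounded below on a ball. -/
theorem exists_polarForm {H : ℝ × ℝ → ℝ} (hH : AnalyticAt ℝ H 0) (hH0 : H 0 = 0)
    (hc : IsNondegenerateCenter H) (hsign : ∀ᶠ z in 𝓝 (0 : ℝ × ℝ), 0 ≤ H z) :
    Nonempty (PolarForm H) := by
  have hd := hc.fderiv_eq_zero
  have hv0 := hc.singular
  have hH' : ∀ v : ℝ × ℝ, AnalyticAt ℝ (fun z => fderiv ℝ H z v) 0 := fun v =>
    ((ContinuousLinearMap.apply ℝ ℝ v).analyticAt _).comp hH.fderiv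
  have hv1 : AnalyticAt ℝ (fun z => (hamField H z).1) 0 := (hH' (0, 1)).neg
  have hv2 : AnalyticAt ℝ (fun z => (hamField H z).2) 0 := hH' (1, 0)
  obtain ⟨N, hN, hN0, hN1, δ₀, hδ₀, hNR⟩ := exists_superposition hH
  obtain ⟨N₁, hN₁, hN₁0, hN₁1, δ₁, hδ₁, hN₁R⟩ := exists_superposition hv1
  obtain ⟨N₂, hN₂, hN₂0, hN₂1, δ₂, hδ₂, hN₂R⟩ := exists_superposition hv2
  set C : ℝ →ᵇ ℝ := BoundedContinuousFunction.ofNormedAddCommGroup cos continuous_cos 1 abs_cos_le_one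
  set S : ℝ →ᵇ ℝ := BoundedContinuousFunction.ofNormedAddCommGroup sin continuous_sin 1 abs_sin_le_one
  have hCapp : ∀ θ, C θ = cos θ := fun _ => rfl
  have hSapp : ∀ θ, S θ = sin θ := fun _ => rfl
  set Rad : (ℝ →ᵇ ℝ) → (ℝ →ᵇ ℝ) := fun R => C * N₁ 0 R + S * N₂ 0 R with hRad
  set Ang : (ℝ →ᵇ ℝ) → (ℝ →ᵇ ℝ) := fun R => C * N₂ 1 R - S * N₁ 1 R with hAng
  have hRadA : AnalyticAt ℝ Rad 0 :=
    (analyticAt_const.mul (hN₁ 0)).add (analyticAt_const.mul (hN₂ 0))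
  have hAngA : AnalyticAt ℝ Ang 0 :=
    (analyticAt_const.mul (hN₂ 1)).sub (analyticAt_const.mul (hN₁ 1))
  obtain ⟨δ₃, hδ₃, hδ₃H⟩ := Metric.eventually_nhds_iff_ball.mp hH.eventually_analyticAt
  have hE : ∀ R : ℝ →ᵇ ℝ, ‖R‖ < δ₀ → ∀ θ, R θ ^ 2 * N 2 R θ = H (R θ • unitVec θ) := by
    intro R hR θ
    rw [← (hNR R hR).1 θ, (hNR R hR).2 0, (hNR R hR).2 1]
    simp only [BoundedContinuousFunction.add_apply, BoundedContinuousFunction.mul_apply, hN0, hN1,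
      hH0, hd, _root_.zero_apply]
    ring
  have hAngR : ∀ R : ℝ →ᵇ ℝ, ‖R‖ < δ₁ → ‖R‖ < δ₂ → ∀ θ,
      R θ * Ang R θ = angularComp H (R θ) θ := by
    intro R hR1 hR2 θ
    rw [angularComp, ← (hN₁R R hR1).1 θ, ← (hN₂R R hR2).1 θ, (hN₁R R hR1).2 0, (hN₂R R hR2).2 0]
    simp only [hAng, BoundedContinuousFunction.add_apply, BoundedContinuousFunction.mul_apply,
      BoundedContinuousFunction.sub_apply, hN₁0, hN₂0, hv0, hCapp, hSapp, Prod.fst_zero,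
      Prod.snd_zero]
    ring
  have hline : AnalyticAt ℝ (fun r : ℝ => r • (1 : ℝ →ᵇ ℝ)) 0 := by fun_prop
  have hsmall : ∀ ε > 0, ∀ᶠ r : ℝ in 𝓝 0, ‖r • (1 : ℝ →ᵇ ℝ)‖ < ε := fun ε hε => by
    refine hline.continuousAt.norm.eventually_lt continuousAt_const ?_
    simpa using hε
  have heval : ∀ (F : (ℝ →ᵇ ℝ) → (ℝ →ᵇ ℝ)), AnalyticAt ℝ F 0 → ∀ θ,
      AnalyticAt ℝ (fun r : ℝ => F (r • (1 : ℝ →ᵇ ℝ)) θ) 0 := fun F hF θ =>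
    AnalyticAt.eval_apply (hF.comp_of_eq hline (zero_smul ℝ _)) θ
  have hone : ∀ r θ : ℝ, (r • (1 : ℝ →ᵇ ℝ)) θ = r := fun r θ => by simp
  have hEnonneg : ∀ θ, 0 ≤ N 2 0 θ := fun θ => by
    have hcont : Tendsto (fun r : ℝ => N 2 (r • (1 : ℝ →ᵇ ℝ)) θ) (𝓝[≠] 0) (𝓝 (N 2 0 θ)) := by
      simpa using (heval _ (hN 2) θ).continuousAt.tendsto.mono_left nhdsWithin_le_nhds
    refine ge_of_tendsto hcont ?_
    have hray : Tendsto (fun r : ℝ => r • unitVec θ) (𝓝[≠] 0) (𝓝 0) := by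
      have : Continuous fun r : ℝ => r • unitVec θ := by fun_prop
      simpa using (this.tendsto 0).mono_left nhdsWithin_le_nhds
    filter_upwards [hray.eventually hsign, nhdsWithin_le_nhds (hsmall δ₀ hδ₀),
      self_mem_nhdsWithin] with r h1 h2 h3
    rw [← hone r θ, ← hE _ h2, hone] at h1
    exact nonneg_of_mul_nonneg_right h1 (by have : r ≠ 0 := h3; positivity)
  -- Compare the coefficients of degree one in ∂H/∂r = r θ', where H = r² E along the ray.
  have hE2 : ∀ θ, Ang 0 θ = 2 * N 2 0 θ := fun θ => by
    have h1 : taylorCoeff (fun r => H (r • unitVec θ)) 2 = N 2 0 θ := by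
      have : (fun r => H (r • unitVec θ)) =ᶠ[𝓝 0] fun r => r ^ 2 * N 2 (r • (1 : ℝ →ᵇ ℝ)) θ := by
        filter_upwards [hsmall δ₀ hδ₀] with r hr
        have := hE _ hr θ
        rw [hone] at this
        exact this.symm
      rw [← coeff_taylorSeries, taylorSeries_congr this, taylorSeries_mul (by fun_prop)
        (heval _ (hN 2) θ), taylorSeries_pow (by fun_prop), taylorSeries_id,
        PowerSeries.coeff_X_pow_mul', if_pos le_rfl]
      simp
    have h2 : deriv (fun r => H (r • unitVec θ)) =ᶠ[𝓝 0] fun r => r * Ang (r • (1 : ℝ →ᵇ ℝ)) θ := by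
      filter_upwards [hsmall δ₁ hδ₁, hsmall δ₂ hδ₂, Metric.ball_mem_nhds (0 : ℝ) hδ₃]
        with r hr1 hr2 hr3
      have hz : r • unitVec θ ∈ Metric.ball (0 : ℝ × ℝ) δ₃ := by
        rw [mem_ball_zero_iff] at hr3 ⊢
        rw [norm_smul]
        exact (mul_le_of_le_one_right (norm_nonneg _) (norm_unitVec_le θ)).trans_lt hr3
      rw [(hasDerivAt_ray (hδ₃H _ hz).differentiableAt).deriv]
      have := hAngR _ hr1 hr2 θ
      rw [hone] at this
      exact this.symm
    have h3 := taylorCoeff_deriv (fun r => H (r • unitVec θ)) 1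
    rw [taylorCoeff_congr h2, h1, ← coeff_taylorSeries, taylorSeries_mul (by fun_prop)
      (heval _ hAngA θ), taylorSeries_id, show 1 = 0 + 1 from rfl, PowerSeries.coeff_succ_X_mul] at h3
    simp at h3
    linarith
  obtain ⟨q, hq, hqle⟩ : ∃ q > 0, ∀ θ, q ≤ Ang 0 θ := by
    set D := fderiv ℝ (hamField H) 0 with hDdef
    have hham : DifferentiableAt ℝ (hamField H) 0 :=
      (hv1.prod hv2).differentiableAt
    have hD1 : fderiv ℝ (fun z => (hamField H z).1) 0 = (ContinuousLinearMap.fst ℝ ℝ ℝ).comp D :=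
      hham.hasFDerivAt.fst.fderiv
    have hD2 : fderiv ℝ (fun z => (hamField H z).2) 0 = (ContinuousLinearMap.snd ℝ ℝ ℝ).comp D :=
      hham.hasFDerivAt.snd.fderiv
    have happ : ∀ v w : ℝ × ℝ, fderiv ℝ (fun z => fderiv ℝ H z v) 0 w =
        fderiv ℝ (fderiv ℝ H) 0 w v := fun v w => by
      rw [fderiv_clm_apply hH.fderiv.differentiableAt (differentiableAt_const v)]
      simp
    have hD1' : ∀ w, (D w).1 = -(fderiv ℝ (fderiv ℝ H) 0 w (0, 1)) := fun w => by
      rw [← happ, ← _root_.neg_apply, ← fderiv_fun_neg]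
      exact (DFunLike.congr_fun hD1 w).symm
    have hD2' : ∀ w, (D w).2 = fderiv ℝ (fderiv ℝ H) 0 w (1, 0) := fun w => by
      rw [← happ]
      exact (DFunLike.congr_fun hD2 w).symm
    have hsymm : IsSymmSndFDerivAt ℝ H 0 :=
      (hH.contDiffAt (n := 2)).isSymmSndFDerivAt (by simp)
    set a := (D (1, 0)).2 with ha
    set b := (D (0, 1)).2 with hb
    set d := -(D (0, 1)).1 with hd'
    have hb' : (D (1, 0)).1 = -b := by
      rw [hD1', hb, hD2', hsymm.eq]
    have hlin : ∀ θ, D (unitVec θ) = cos θ • D (1, 0) + sin θ • D (0, 1) := fun θ => by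
      rw [← map_smul, ← map_smul, ← map_add]
      simp [unitVec]
    have hAng0 : ∀ θ, Ang 0 θ = a * cos θ ^ 2 + 2 * b * (sin θ * cos θ) + d * sin θ ^ 2 := by
      intro θ
      simp only [hAng, BoundedContinuousFunction.mul_apply, BoundedContinuousFunction.sub_apply,
        hN₁1, hN₂1, hCapp, hSapp, hD1, hD2, ContinuousLinearMap.comp_apply, hlin,
        ContinuousLinearMap.coe_fst', ContinuousLinearMap.coe_snd', Prod.fst_add, Prod.snd_add,
        Prod.smul_fst, Prod.smul_snd, smul_eq_mul, hb', ← ha, ← hb]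
      rw [hd']
      ring
    have hdet : a * d - b ^ 2 ≠ 0 := by
      have h := hc.nondegenerate
      rw [← hDdef, ContinuousLinearMap.det, ← LinearMap.det_toMatrix (Module.Basis.finTwoProd ℝ),
        Matrix.det_fin_two] at h
      simp only [LinearMap.toMatrix_apply, Module.Basis.finTwoProd_zero,
        Module.Basis.finTwoProd_one, Module.Basis.coe_finTwoProd_repr,
        ContinuousLinearMap.coe_coe, Matrix.cons_val_zero, Matrix.cons_val_one] at h
      rw [hb', ← ha, ← hb] at h
      intro h0
      apply h
      rw [hd'] at h0
      linarith
    obtain ⟨c, hc, hle⟩ := exists_pos_le_quadratic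
      (fun θ => by rw [← hAng0, hE2]; linarith [hEnonneg θ]) hdet
    exact ⟨c, hc, fun θ => (hAng0 θ).symm ▸ hle θ⟩
  -- Since Ang 0 = 2 E(0, ·), both operators are at least q/2 at R = 0; a perturbation smaller than
  -- q/4 leaves q/4.
  have hlow : ∀ F : (ℝ →ᵇ ℝ) → (ℝ →ᵇ ℝ), AnalyticAt ℝ F 0 → (∀ θ, q / 2 ≤ F 0 θ) →
      ∃ δ > 0, ∀ R : ℝ →ᵇ ℝ, ‖R‖ < δ → ∀ θ, q / 4 ≤ F R θ := fun F hF h0 => by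
    obtain ⟨δ, hδ, h⟩ := Metric.continuousAt_iff.mp hF.continuousAt (q / 4) (by positivity)
    refine ⟨δ, hδ, fun R hR θ => ?_⟩
    have h1 := (BoundedContinuousFunction.dist_coe_le_dist θ).trans_lt (h (by simpa using hR))
    rw [Real.dist_eq] at h1
    linarith [(abs_lt.mp h1).1, h0 θ]
  obtain ⟨δ₄, hδ₄, h4⟩ := hlow Ang hAngA fun θ => by linarith [hqle θ]
  obtain ⟨δ₅, hδ₅, h5⟩ := hlow (N 2) (hN 2) fun θ => by linarith [hqle θ, hE2 θ]
  exact ⟨{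
    radial := Rad
    angular := Ang
    energy := N 2
    δ := min (min δ₀ (min δ₁ δ₂)) (min δ₃ (min δ₄ δ₅))
    κ := q / 4
    δ_pos := by positivity
    κ_pos := by positivity
    analyticAt_radial := hRadA
    analyticAt_angular := hAngA
    analyticAt_energy := hN 2
    analyticAt := fun z hz => hδ₃H z (by simp only [lt_min_iff] at hz; simpa using hz.2.1)
    radial_apply := fun R hR θ => by
      simp only [lt_min_iff] at hR
      rw [radialComp, ← (hN₁R R hR.1.2.1).1 θ, ← (hN₂R R hR.1.2.2).1 θ]
      rfl
    mul_angular_apply := fun R hR => by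
      simp only [lt_min_iff] at hR
      exact hAngR R hR.1.2.1 hR.1.2.2
    sq_mul_energy_apply := fun R hR => by
      simp only [lt_min_iff] at hR
      exact hE R hR.1.1
    le_angular := fun R hR => by
      simp only [lt_min_iff] at hR
      exact h4 R hR.2.2.1
    le_energy := fun R hR => by
      simp only [lt_min_iff] at hR
      exact h5 R hR.2.2.2 }⟩

end PolarForm

/-! ### Level curves by the implicit function theorem. -/

section LevelCurve

open BoundedContinuousFunction
open scoped ContDiff

theorem unitVec_add_pi (θ : ℝ) : unitVec (θ + π) = -unitVec θ := by
  simp [unitVec, cos_add_pi, sin_add_pi]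

theorem smul_unitVec_norm_lt {r θ δ : ℝ} (h : |r| < δ) : ‖r • unitVec θ‖ < δ := by
  rw [norm_smul]
  exact (mul_le_of_le_one_right (norm_nonneg _) (norm_unitVec_le θ)).trans_lt h

namespace PolarForm

variable {H : ℝ × ℝ → ℝ} (D : PolarForm H)

include D in
theorem differentiableAt_ray {r : ℝ} (θ : ℝ) (h : |r| < D.δ) :
    DifferentiableAt ℝ H (r • unitVec θ) :=
  (D.analyticAt _ (smul_unitVec_norm_lt h)).differentiableAt

theorem norm_smul_one_lt {r : ℝ} (h : |r| < D.δ) : ‖r • (1 : ℝ →ᵇ ℝ)‖ < D.δ := by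
  rwa [norm_smul, norm_one, mul_one]

theorem angularComp_pos {r : ℝ} (θ : ℝ) (h0 : 0 < r) (h : r < D.δ) : 0 < angularComp H r θ := by
  have h1 := D.norm_smul_one_lt (r := r) (by rwa [abs_of_pos h0])
  have h2 := D.mul_angular_apply _ h1 θ
  have h3 := D.le_angular _ h1 θ
  simp only [BoundedContinuousFunction.coe_smul, BoundedContinuousFunction.coe_one, Pi.one_apply, smul_eq_mul,
    mul_one] at h2
  rw [← h2]
  exact mul_pos h0 (D.κ_pos.trans_le h3)

/-- The radial derivative is r θ' > 0. The resulting uniqueness of the radius on each ray gives the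
symmetry of the level curves, their description as level sets, and the region that they enclose. -/
theorem strictMonoOn_ray (θ : ℝ) : StrictMonoOn (fun r => H (r • unitVec θ)) (Ico 0 D.δ) := by
  have habs : ∀ r ∈ Ico 0 D.δ, |r| < D.δ := fun r hr => by rw [abs_of_nonneg hr.1]; exact hr.2
  refine strictMonoOn_of_deriv_pos (convex_Ico _ _) (fun r hr => ?_) fun r hr => ?_
  · exact (hasDerivAt_ray (D.differentiableAt_ray θ (habs r hr))).continuousAt.continuousWithinAt
  · rw [interior_Ico] at hr
    rw [(hasDerivAt_ray (D.differentiableAt_ray θ (habs r ⟨hr.1.le, hr.2⟩))).deriv]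
    exact D.angularComp_pos θ hr.1 hr.2

/-- The equation R² E(R) = z² degenerates at R = 0; substituting R = zW and dividing by z² removes
the degeneracy. At z = 0 the solution is E(0, ·)^(-1/2), bounded away from 0. -/
theorem exists_implicit : ∃ W : ℝ → (ℝ →ᵇ ℝ), AnalyticAt ℝ W 0 ∧
    (∃ w > 0, ∀ θ, w ≤ W 0 θ) ∧ ∀ᶠ z in 𝓝 0, W z ^ 2 * D.energy (z • W z) = 1 := by
  have hE0 : ∀ θ, D.κ ≤ D.energy 0 θ := D.le_energy 0 (by simpa using D.δ_pos)
  have hE0' : ∀ θ, 0 < D.energy 0 θ := fun θ => D.κ_pos.trans_le (hE0 θ)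
  have hκ := Real.sqrt_pos.mpr D.κ_pos
  set W₀ : ℝ →ᵇ ℝ := BoundedContinuousFunction.ofNormedAddCommGroup
    (fun θ => (√(D.energy 0 θ))⁻¹)
    ((Real.continuous_sqrt.comp (D.energy 0).continuous).inv₀
      fun θ => (Real.sqrt_pos.mpr (hE0' θ)).ne') (√D.κ)⁻¹ (fun θ => by
        rw [norm_inv, Real.norm_of_nonneg (Real.sqrt_nonneg _)]
        exact inv_anti₀ hκ (Real.sqrt_le_sqrt (hE0 θ)))
  have hW₀app : ∀ θ, W₀ θ = (√(D.energy 0 θ))⁻¹ := fun _ => rfl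
  have hW₀ : W₀ ^ 2 * D.energy 0 = 1 := by
    ext θ
    simp only [BoundedContinuousFunction.mul_apply, BoundedContinuousFunction.coe_pow,
      Pi.pow_apply, hW₀app, BoundedContinuousFunction.coe_one, Pi.one_apply, inv_pow,
      Real.sq_sqrt (hE0' θ).le]
    exact inv_mul_cancel₀ (hE0' θ).ne'
  set f : ℝ × (ℝ →ᵇ ℝ) → (ℝ →ᵇ ℝ) := fun p => p.2 ^ 2 * D.energy (p.1 • p.2) with hf
  have hfA : AnalyticAt ℝ f (0, W₀) := by
    have h1 : AnalyticAt ℝ (fun p : ℝ × (ℝ →ᵇ ℝ) => p.1 • p.2) (0, W₀) :=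
      analyticAt_fst.smul analyticAt_snd
    exact (analyticAt_snd.pow 2).mul (D.analyticAt_energy.comp_of_eq h1 (zero_smul ℝ _))
  have hcd : ContDiffAt ℝ ω f (0, W₀) := hfA.contDiffAt
  have hpartial : fderiv ℝ f (0, W₀) ∘L .inr ℝ ℝ (ℝ →ᵇ ℝ) =
      ContinuousLinearMap.mul ℝ (ℝ →ᵇ ℝ) (2 * W₀ * D.energy 0) := by
    have h1 : HasFDerivAt (fun W : ℝ →ᵇ ℝ => f (0, W))
        (fderiv ℝ f (0, W₀) ∘L .inr ℝ ℝ (ℝ →ᵇ ℝ)) W₀ :=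
      hfA.differentiableAt.hasFDerivAt.comp W₀ (hasFDerivAt_prodMk_right 0 W₀)
    have h2 : HasFDerivAt (fun W : ℝ →ᵇ ℝ => f (0, W))
        (ContinuousLinearMap.mul ℝ (ℝ →ᵇ ℝ) (2 * W₀ * D.energy 0)) W₀ := by
      have : (fun W : ℝ →ᵇ ℝ => f (0, W)) = fun W => W ^ 2 * D.energy 0 := by
        funext W; simp only [hf, zero_smul]
      rw [this]
      refine (((hasFDerivAt_id W₀).pow 2).mul_const (D.energy 0)).congr_fderiv ?_
      ext1 V
      simp only [id, _root_.smul_apply, ContinuousLinearMap.mul_apply', smul_eq_mul, nsmul_eq_mul,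
        Nat.cast_ofNat, ContinuousLinearMap.id_apply]
      ring
    exact h1.unique h2
  have hinv : (fderiv ℝ f (0, W₀) ∘L .inr ℝ ℝ (ℝ →ᵇ ℝ)).IsInvertible := by
    rw [hpartial]
    -- The partial derivative in W is multiplication by 2W₀E(0), whose inverse is multiplication by
    -- W₀/2, because W₀² E(0) = 1.
    have hc : (2 * W₀ * D.energy 0) * ((1 / 2 : ℝ) • W₀) = 1 := by
      rw [← hW₀]
      ext θ
      simp only [BoundedContinuousFunction.mul_apply, BoundedContinuousFunction.coe_smul,
        BoundedContinuousFunction.coe_ofNat, Pi.ofNat_apply, smul_eq_mul,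
        BoundedContinuousFunction.coe_pow, Pi.pow_apply]
      ring
    refine ⟨ContinuousLinearEquiv.equivOfInverse
      (ContinuousLinearMap.mul ℝ (ℝ →ᵇ ℝ) (2 * W₀ * D.energy 0))
      (ContinuousLinearMap.mul ℝ (ℝ →ᵇ ℝ) ((1 / 2 : ℝ) • W₀))
      (fun V => ?_) (fun V => ?_), by ext1; rfl⟩
    · rw [ContinuousLinearMap.mul_apply', ContinuousLinearMap.mul_apply', ← mul_assoc,
        mul_comm _ (2 * W₀ * D.energy 0), hc, one_mul]
    · rw [ContinuousLinearMap.mul_apply', ContinuousLinearMap.mul_apply', ← mul_assoc, hc, one_mul]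
  refine ⟨hcd.implicitFunction (by simp) hinv,
    (hcd.contDiffAt_implicitFunction (by simp) hinv).analyticAt, ?_, ?_⟩
  · have h0 := hcd.implicitFunction_apply_self (by simp) hinv
    simp only at h0
    rw [h0]
    refine ⟨(√(‖D.energy 0‖))⁻¹, ?_, fun θ => ?_⟩
    · have : 0 < ‖D.energy 0‖ := (hE0' 0).trans_le ((le_abs_self _).trans
        ((D.energy 0).norm_coe_le_norm 0))
      positivity
    · rw [hW₀app]
      exact inv_anti₀ (Real.sqrt_pos.mpr (hE0' θ)) (Real.sqrt_le_sqrt ((le_abs_self _).trans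
        ((D.energy 0).norm_coe_le_norm θ)))
  · filter_upwards [hcd.eventually_apply_implicitFunction (by simp) hinv] with z hz
    simp only [hf] at hz
    rw [hz, zero_smul, hW₀]

/-- The level curves of `H` near the origin, in polar coordinates: `r = R z θ` is the curve of
energy `z ^ 2`. -/
theorem exists_levelCurve : ∃ R : ℝ → (ℝ →ᵇ ℝ), AnalyticAt ℝ R 0 ∧ R 0 = 0 ∧
    ∃ w > 0, ∀ᶠ z in 𝓝 0, ‖R z‖ < D.δ ∧ ∀ θ, H (R z θ • unitVec θ) = z ^ 2 ∧
      R (-z) θ = -R z (θ + π) ∧ w * z ^ 2 ≤ z * R z θ := by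
  obtain ⟨W, hW, ⟨w, hw, hw0⟩, hWz⟩ := D.exists_implicit
  have hR : AnalyticAt ℝ (fun z => z • W z) 0 := analyticAt_id.smul hW
  have hδ : ∀ᶠ z in 𝓝 0, ‖z • W z‖ < D.δ :=
    hR.continuousAt.norm.eventually_lt continuousAt_const (by simpa using D.δ_pos)
  have hlow : ∀ᶠ z in 𝓝 0, ∀ θ, w / 2 ≤ W z θ := by
    filter_upwards [Metric.continuousAt_iff'.mp hW.continuousAt (w / 2) (by positivity)] with z hz θ
    have h1 := (BoundedContinuousFunction.dist_coe_le_dist θ).trans_lt hz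
    rw [Real.dist_eq] at h1
    linarith [(abs_lt.mp h1).1, hw0 θ]
  have hev : ∀ᶠ z in 𝓝 0, ‖z • W z‖ < D.δ ∧ ∀ θ, H ((z • W z) θ • unitVec θ) = z ^ 2 ∧
      w / 2 * z ^ 2 ≤ z * (z • W z) θ := by
    filter_upwards [hWz, hδ, hlow] with z h1 h2 h3
    refine ⟨h2, fun θ => ⟨?_, ?_⟩⟩
    · rw [← D.sq_mul_energy_apply _ h2]
      have := DFunLike.congr_fun h1 θ
      simp only [BoundedContinuousFunction.mul_apply, BoundedContinuousFunction.coe_pow,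
        Pi.pow_apply, BoundedContinuousFunction.coe_one, Pi.one_apply] at this
      simp only [BoundedContinuousFunction.coe_smul, smul_eq_mul, mul_pow]
      rw [mul_assoc, this, mul_one]
    · simp only [BoundedContinuousFunction.coe_smul, smul_eq_mul]
      nlinarith [h3 θ, sq_nonneg z]
  have hneg : Tendsto (fun z : ℝ => -z) (𝓝 0) (𝓝 0) := by simpa using (continuous_neg.tendsto (0 : ℝ))
  refine ⟨fun z => z • W z, hR, by simp, w / 2, by positivity, ?_⟩
  filter_upwards [hev, hneg.eventually hev] with z h1 h2
  refine ⟨h1.1, fun θ => ⟨(h1.2 θ).1, ?_, (h1.2 θ).2⟩⟩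
  set R := z • W z
  set R' := (-z) • W (-z)
  have hb1 : |R (θ + π)| < D.δ := (R.norm_coe_le_norm _).trans_lt h1.1
  have hb2 : |R' θ| < D.δ := (R'.norm_coe_le_norm _).trans_lt h2.1
  have e1 := (h1.2 (θ + π)).1
  have e2 := (h2.2 θ).1
  have l1 := (h1.2 (θ + π)).2
  have l2 := (h2.2 θ).2
  rw [unitVec_add_pi, smul_neg, ← neg_smul] at e1
  rw [neg_sq] at e2 l2
  -- Up to sign, R(-z, θ) and -R(z, θ + π) are non-negative radii of equal energy on one ray: the
  -- ray θ when z < 0, the ray θ + π when z > 0.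
  rcases lt_trichotomy z 0 with hz | hz | hz
  · have p1 : 0 ≤ -R (θ + π) := by
      by_contra h
      nlinarith [mul_pos_of_neg_of_neg hz hz]
    have p2 : 0 ≤ R' θ := by
      by_contra h
      nlinarith [mul_pos_of_neg_of_neg hz hz]
    exact (D.strictMonoOn_ray θ).injOn ⟨p2, (le_abs_self _).trans_lt hb2⟩
      ⟨p1, (neg_le_abs _).trans_lt hb1⟩ (e2.trans e1.symm)
  · simp [R, R', hz]
  · have p1 : 0 ≤ R (θ + π) := by
      by_contra h
      nlinarith [mul_pos hz hz]
    have p2 : 0 ≤ -R' θ := by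
      by_contra h
      nlinarith [mul_pos hz hz]
    have e1' : H (R (θ + π) • unitVec (θ + π)) = z ^ 2 := (h1.2 (θ + π)).1
    have e2' : H ((-R' θ) • unitVec (θ + π)) = z ^ 2 := by
      rw [unitVec_add_pi, smul_neg, neg_smul, neg_neg, e2]
    have := (D.strictMonoOn_ray (θ + π)).injOn ⟨p2, (neg_le_abs _).trans_lt hb2⟩
      ⟨p1, (le_abs_self _).trans_lt hb1⟩ (e2'.trans e1'.symm)
    linarith

end PolarForm

end LevelCurve

/-! ### A single oval: its periodic orbit, interior and area. -/

section Oval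

open BoundedContinuousFunction

/-- The derivative of a continuous function of one variable given by an implicit equation. -/
theorem hasDerivAt_of_implicit {Φ : ℝ × ℝ → ℝ} {r : ℝ → ℝ} {θ a b c : ℝ}
    (hΦ : HasFDerivAt Φ
      (a • ContinuousLinearMap.fst ℝ ℝ ℝ - b • ContinuousLinearMap.snd ℝ ℝ ℝ) (r θ, θ))
    (ha : a ≠ 0) (hr : ContinuousAt r θ) (h : ∀ s, Φ (r s, s) = c) :
    HasDerivAt r (b / a) θ := by
  have hlim : Tendsto (fun s => (r s, s)) (𝓝 θ) (𝓝 (r θ, θ)) := hr.prodMk continuousAt_id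
  have hΦ' := hΦ.isLittleO.comp_tendsto hlim
  rw [hasDerivAt_iff_isLittleO, Asymptotics.isLittleO_iff]
  intro ε hε
  have ha' : 0 < |a| := abs_pos.mpr ha
  set K := 1 + |b / a| with hK
  have hKpos : 0 < K := by positivity
  -- With x and y the increments of r and θ, e = |x - y b/a| satisfies e ≤ η(e + K|y|). The bound η
  -- ≤ 1/2 absorbs e on the left, and 2ηK ≤ ε then gives e ≤ ε|y|.
  set η := min (1 / 2) (ε / (2 * K)) with hη
  have hηpos : 0 < η := by positivity
  filter_upwards [(Asymptotics.isLittleO_iff.mp hΦ') (mul_pos ha' hηpos)] with s hs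
  simp only [Function.comp, h, sub_self, Prod.mk_sub_mk, _root_.sub_apply,
    _root_.smul_apply, ContinuousLinearMap.coe_fst', ContinuousLinearMap.coe_snd', smul_eq_mul,
    zero_sub, norm_neg] at hs ⊢
  set x := r s - r θ
  set y := s - θ
  have h1 : |a * x - b * y| = |a| * |x - y * (b / a)| := by
    rw [← abs_mul]; congr 1; field_simp
  rw [Real.norm_eq_abs, h1, mul_assoc] at hs
  have h2 : |x - y * (b / a)| ≤ η * ‖(x, y)‖ := le_of_mul_le_mul_left hs ha'
  have h3 : ‖(x, y)‖ ≤ |x - y * (b / a)| + K * |y| := by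
    have : |x| ≤ |x - y * (b / a)| + |y * (b / a)| := by
      simpa using abs_add_le (x - y * (b / a)) (y * (b / a))
    rw [abs_mul] at this
    rw [Prod.norm_def, Real.norm_eq_abs, Real.norm_eq_abs, hK]
    refine max_le ?_ ?_
    · nlinarith [abs_nonneg y]
    · nlinarith [abs_nonneg y, abs_nonneg (b / a), abs_nonneg (x - y * (b / a)),
        mul_nonneg (abs_nonneg y) (abs_nonneg (b / a))]
  have h4 : η ≤ 1 / 2 := min_le_left _ _
  have h5 : η * (2 * K) ≤ ε := by
    rw [← le_div_iff₀ (by positivity)]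
    exact min_le_right _ _
  rw [Real.norm_eq_abs, Real.norm_eq_abs]
  have h6 := mul_le_mul_of_nonneg_left h3 hηpos.le
  have h7 := mul_le_mul_of_nonneg_right h4 (abs_nonneg (x - y * (b / a)))
  have h8 := mul_le_mul_of_nonneg_right h5 (abs_nonneg y)
  nlinarith

/-- The inverse of a primitive of a continuous function bounded below by a positive constant. -/
theorem exists_inverse_primitive {G : ℝ → ℝ} (hG : Continuous G) {m : ℝ} (hm : 0 < m)
    (hmG : ∀ θ, m ≤ G θ) (θ₀ : ℝ) :
    ∃ Θ : ℝ → ℝ, (∀ t, ∫ s in θ₀..Θ t, G s = t) ∧ (∀ θ, Θ (∫ s in θ₀..θ, G s) = θ) ∧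
      StrictMono Θ ∧ ∀ t, HasDerivAt Θ (G (Θ t))⁻¹ t := by
  set τ : ℝ → ℝ := fun θ => ∫ s in θ₀..θ, G s with hτ
  have hder : ∀ θ, HasDerivAt τ (G θ) θ := fun θ =>
    (hG.integral_hasStrictDerivAt θ₀ θ).hasDerivAt
  have hpos : ∀ θ, 0 < G θ := fun θ => hm.trans_le (hmG θ)
  have hmono : StrictMono τ := strictMono_of_deriv_pos fun θ => by rw [(hder θ).deriv]; exact hpos θ
  have hcont : Continuous τ := continuous_iff_continuousAt.mpr fun θ => (hder θ).continuousAt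
  -- The primitive grows at least linearly in both directions, hence is onto.
  have hdiff : Monotone fun θ => τ θ - m * θ := by
    have hd : ∀ θ, HasDerivAt (fun θ => τ θ - m * θ) (G θ - m * 1) θ := fun θ =>
      (hder θ).sub ((hasDerivAt_id θ).const_mul m)
    refine monotone_of_deriv_nonneg (fun θ => (hd θ).differentiableAt) fun θ => ?_
    rw [(hd θ).deriv]
    linarith [hmG θ]
  have htop : Tendsto τ atTop atTop := by
    refine tendsto_atTop_mono' atTop (f₁ := fun θ => τ 0 + m * θ) ?_ ?_
    · filter_upwards [eventually_ge_atTop 0] with θ hθ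
      have := hdiff hθ
      simp only at this
      linarith
    · exact tendsto_atTop_add_const_left _ _ (tendsto_id.const_mul_atTop hm)
  have hbot : Tendsto τ atBot atBot := by
    refine tendsto_atBot_mono' atBot (?_ : τ ≤ᶠ[atBot] fun θ => τ 0 + m * θ) ?_
    · filter_upwards [eventually_le_atBot 0] with θ hθ
      have := hdiff hθ
      simp only at this
      linarith
    · exact tendsto_atBot_add_const_left _ _ (tendsto_id.const_mul_atBot hm)
  set e := hmono.orderIsoOfSurjective τ (hcont.surjective htop hbot) with he
  have hright : ∀ t, τ (e.symm t) = t := fun t => e.apply_symm_apply t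
  refine ⟨e.symm, hright, fun θ => e.symm_apply_apply θ, e.symm.strictMono, fun t => ?_⟩
  exact (hder (e.symm t)).of_local_left_inverse e.symm.continuous.continuousAt (hpos _).ne'
    (Eventually.of_forall hright)

theorem unitVec_sq_add_sq (r θ : ℝ) : (r • unitVec θ).1 ^ 2 + (r • unitVec θ).2 ^ 2 = r ^ 2 := by
  rw [smul_unitVec]
  linear_combination r ^ 2 * cos_sq_add_sin_sq θ

theorem unitVec_add_two_pi (θ : ℝ) : unitVec (θ + 2 * π) = unitVec θ := by
  simp [unitVec]

namespace PolarForm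

variable {H : ℝ × ℝ → ℝ}

/-- `r = R(θ)` is the polar equation of the level curve `{H = h}`. -/
structure IsOval (D : PolarForm H) (h : ℝ) (R : ℝ →ᵇ ℝ) : Prop where
  norm_lt : ‖R‖ < D.δ
  pos : ∀ θ, 0 < R θ
  level : ∀ θ, H (R θ • unitVec θ) = h
  periodic : Function.Periodic R (2 * π)

/-- The disc in which the polar form of the system is used. -/
def disc (D : PolarForm H) : Set (ℝ × ℝ) := {p | p.1 ^ 2 + p.2 ^ 2 < D.δ ^ 2}

theorem disc_mem_nhds (D : PolarForm H) : D.disc ∈ 𝓝 (0 : ℝ × ℝ) := by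
  have hc : Continuous fun p : ℝ × ℝ => p.1 ^ 2 + p.2 ^ 2 := by fun_prop
  refine (isOpen_lt hc continuous_const).mem_nhds ?_
  simpa using pow_pos D.δ_pos 2

theorem isOpen_disc (D : PolarForm H) : IsOpen D.disc := by
  have hc : Continuous fun p : ℝ × ℝ => p.1 ^ 2 + p.2 ^ 2 := by fun_prop
  exact isOpen_lt hc continuous_const

theorem smul_unitVec_mem_disc (D : PolarForm H) {r θ : ℝ} (hr : 0 ≤ r) :
    r • unitVec θ ∈ D.disc ↔ r < D.δ := by
  rw [disc, mem_ofPred_eq, unitVec_sq_add_sq]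
  exact pow_lt_pow_iff_left₀ hr D.δ_pos.le (by norm_num)

theorem continuousOn_disc (D : PolarForm H) : ContinuousOn H D.disc := by
  intro p hp
  obtain ⟨r, θ, hr, _, rfl⟩ := exists_eq_smul_unitVec p
  rw [D.smul_unitVec_mem_disc hr] at hp
  exact (D.differentiableAt_ray θ (by rwa [abs_of_nonneg hr])).continuousAt.continuousWithinAt

namespace IsOval

variable {D : PolarForm H} {h : ℝ} {R : ℝ →ᵇ ℝ} (hR : D.IsOval h R)
include hR

theorem lt_delta (θ : ℝ) : R θ < D.δ :=
  ((le_abs_self _).trans (R.norm_coe_le_norm θ)).trans_lt hR.norm_lt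

theorem abs_lt_delta (θ : ℝ) : |R θ| < D.δ := (R.norm_coe_le_norm θ).trans_lt hR.norm_lt

/-- Implicit differentiation of H(R e_θ) = h, with a factor R cancelled: the level curve solves the
orbit equation dr/dθ = r'/θ'. -/
theorem hasDerivAt (θ : ℝ) : HasDerivAt R (D.radial R θ / D.angular R θ) θ := by
  have h1 := hasFDerivAt_polar (D.differentiableAt_ray θ (hR.abs_lt_delta θ))
  have h2 := hasDerivAt_of_implicit h1 (D.angularComp_pos θ (hR.pos θ) (hR.lt_delta θ)).ne'
    R.continuous.continuousAt hR.level
  rwa [← D.mul_angular_apply R hR.norm_lt, ← D.radial_apply R hR.norm_lt,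
    mul_div_mul_left _ _ (hR.pos θ).ne'] at h2

theorem angular_pos (θ : ℝ) : 0 < D.angular R θ := D.κ_pos.trans_le (D.le_angular R hR.norm_lt θ)

theorem angular_periodic : Function.Periodic (D.angular R) (2 * π) := fun θ => by
  have h1 := D.mul_angular_apply R hR.norm_lt (θ + 2 * π)
  have h2 := D.mul_angular_apply R hR.norm_lt θ
  rw [hR.periodic θ, angularComp, unitVec_add_two_pi, cos_add_two_pi, sin_add_two_pi,
    ← angularComp, ← h2] at h1
  exact mul_left_cancel₀ (hR.pos θ).ne' h1

theorem continuous_inv_angular : Continuous fun θ => (D.angular R θ)⁻¹ :=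
  (D.angular R).continuous.inv₀ fun θ => (hR.angular_pos θ).ne'

/-- The level curve carries a periodic solution whose minimal period is the integral of
`dt / dθ` over one turn. -/
theorem exists_periodicOrbit : ∃ γ : ℝ → ℝ × ℝ, γ 0 = (0, R (π / 2)) ∧
    IsPeriodicOrbit H γ (∫ θ in (π / 2)..(π / 2 + 2 * π), (D.angular R θ)⁻¹) ∧
    range γ = range fun θ => R θ • unitVec θ := by
  have hm : 0 < ‖D.angular R‖ :=
    (hR.angular_pos 0).trans_le ((le_abs_self _).trans ((D.angular R).norm_coe_le_norm 0))
  -- Time along the curve is a primitive of 1/θ'; its inverse Θ gives the angle as a function of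
  -- time.
  obtain ⟨Θ, hΘ, hΘ', hmono, hder⟩ := exists_inverse_primitive hR.continuous_inv_angular
    (inv_pos.mpr hm) (fun θ => inv_anti₀ (hR.angular_pos θ)
      ((le_abs_self _).trans ((D.angular R).norm_coe_le_norm θ))) (π / 2)
  have hΘ0 : Θ 0 = π / 2 := by simpa using hΘ' (π / 2)
  have hadd : ∀ θ, ∫ s in (π / 2)..(θ + 2 * π), (D.angular R s)⁻¹ =
      (∫ s in (π / 2)..θ, (D.angular R s)⁻¹) +
        ∫ s in (π / 2)..(π / 2 + 2 * π), (D.angular R s)⁻¹ := fun θ => by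
    have hper : Function.Periodic (fun s => (D.angular R s)⁻¹) (2 * π) := fun s => by
      simp only [hR.angular_periodic s]
    rw [← hper.intervalIntegral_add_eq θ (π / 2), intervalIntegral.integral_add_adjacent_intervals
      (hR.continuous_inv_angular.intervalIntegrable _ _)
      (hR.continuous_inv_angular.intervalIntegrable _ _)]
  refine ⟨fun t => R (Θ t) • unitVec (Θ t), ?_, ⟨fun t => ?_, ⟨?_, ?_⟩, ?_⟩, ?_⟩
  · beta_reduce
    rw [hΘ0, smul_unitVec]
    simp
  · have hRΘ : HasDerivAt (fun t => R (Θ t)) _ t := (hR.hasDerivAt (Θ t)).comp t (hder t)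
    have h1 := hRΘ.mul ((hasDerivAt_cos (Θ t)).comp t (hder t))
    have h2 := hRΘ.mul ((hasDerivAt_sin (Θ t)).comp t (hder t))
    have hcs := cos_sq_add_sin_sq (Θ t)
    have hA : (D.angular R (Θ t)) ≠ 0 := (hR.angular_pos _).ne'
    have hrad := D.radial_apply R hR.norm_lt (Θ t)
    have hang := D.mul_angular_apply R hR.norm_lt (Θ t)
    rw [radialComp] at hrad
    rw [angularComp] at hang
    have hR' : D.radial R (Θ t) / D.angular R (Θ t) * ((D.angular R (Θ t))⁻¹)⁻¹ =
        D.radial R (Θ t) := by field_simp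
    refine (h1.prodMk h2).congr_deriv (Prod.ext ?_ ?_)
    · simp only [Function.comp]
      rw [hR', inv_inv, hrad]
      linear_combination (-sin (Θ t)) * hang +
        (hamField H (R (Θ t) • unitVec (Θ t))).1 * hcs
    · simp only [Function.comp]
      rw [hR', inv_inv, hrad]
      linear_combination cos (Θ t) * hang +
        (hamField H (R (Θ t) • unitVec (Θ t))).2 * hcs
  · have := hΘ' (π / 2 + 2 * π)
    rw [← hΘ0] at this
    have hlt : (0 : ℝ) < 2 * π := by positivity
    by_contra hneg
    have h3 := hmono.monotone (not_lt.mp hneg)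
    rw [hΘ', hΘ0] at h3
    linarith
  · intro t
    have : Θ (t + ∫ θ in (π / 2)..(π / 2 + 2 * π), (D.angular R θ)⁻¹) = Θ t + 2 * π := by
      rw [← hΘ' (Θ t + 2 * π), hadd (Θ t), hΘ]
    simp only [this, hR.periodic (Θ t), unitVec_add_two_pi]
  -- A return to the starting point advances the angle by 2πk; as Θ increases, k ≥ 1, so at least
  -- one full turn has elapsed.
  · rintro s ⟨hs, hper⟩
    have h0 := hper 0
    rw [zero_add] at h0
    simp only [hΘ0] at h0
    have hRs : R (Θ s) = R (π / 2) := by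
      have h1 := unitVec_sq_add_sq (R (Θ s)) (Θ s)
      rw [h0, unitVec_sq_add_sq] at h1
      exact ((sq_eq_sq₀ (hR.pos _).le (hR.pos _).le).mp h1).symm
    rw [hRs, smul_right_inj (hR.pos _).ne', unitVec, unitVec, Prod.mk.injEq] at h0
    have hang : (Θ s : Real.Angle) = ((π / 2 : ℝ) : Real.Angle) :=
      Real.Angle.cos_sin_inj h0.1 h0.2
    rw [Real.Angle.angle_eq_iff_two_pi_dvd_sub] at hang
    obtain ⟨k, hk⟩ := hang
    have hlt : π / 2 < Θ s := hΘ0 ▸ hmono hs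
    have hk1 : (1 : ℝ) ≤ k := by
      have : 0 < k := by
        by_contra hk0
        have : (k : ℝ) ≤ 0 := by exact_mod_cast not_lt.mp hk0
        nlinarith [pi_pos]
      exact_mod_cast this
    rw [← hmono.le_iff_le, hΘ']
    nlinarith [pi_pos]
  · have hsurj : Function.Surjective Θ := fun θ => ⟨_, hΘ' θ⟩
    exact hsurj.range_comp fun θ => R θ • unitVec θ

theorem range_eq : (range fun θ => R θ • unitVec θ) = {p | p ∈ D.disc ∧ H p = h} := by
  ext p
  constructor
  · rintro ⟨θ, rfl⟩
    exact ⟨(D.smul_unitVec_mem_disc (hR.pos θ).le).mpr (hR.lt_delta θ), hR.level θ⟩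
  · rintro ⟨hp, hph⟩
    obtain ⟨r, θ, hr, _, rfl⟩ := exists_eq_smul_unitVec p
    rw [D.smul_unitVec_mem_disc hr] at hp
    refine ⟨θ, ?_⟩
    simp only
    rw [(D.strictMonoOn_ray θ).injOn ⟨(hR.pos θ).le, hR.lt_delta θ⟩ ⟨hr, hp⟩
      ((hR.level θ).trans hph.symm)]

theorem mem_sublevel_iff {r θ : ℝ} (hr : 0 ≤ r) :
    r • unitVec θ ∈ {p | p ∈ D.disc ∧ H p < h} ↔ r < R θ := by
  rw [mem_ofPred_eq, D.smul_unitVec_mem_disc hr]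
  constructor
  · rintro ⟨h1, h2⟩
    rw [← hR.level θ] at h2
    exact ((D.strictMonoOn_ray θ).lt_iff_lt ⟨hr, h1⟩ ⟨(hR.pos θ).le, hR.lt_delta θ⟩).mp h2
  · intro h1
    have h2 := h1.trans (hR.lt_delta θ)
    refine ⟨h2, ?_⟩
    rw [← hR.level θ]
    exact ((D.strictMonoOn_ray θ) ⟨hr, h2⟩ ⟨(hR.pos θ).le, hR.lt_delta θ⟩ h1)

/-- The set I ∪ C is compact and star-shaped, so the complement of C is the disjoint union of two
open sets: I and the exterior. Components meeting I stay in the bounded set I. From an exterior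
point the ray runs to infinity without meeting C, so its component is unbounded. -/
theorem enclosed_eq : enclosed (range fun θ => R θ • unitVec θ) = {p | p ∈ D.disc ∧ H p < h} := by
  set C := range fun θ => R θ • unitVec θ with hC
  set I := {p | p ∈ D.disc ∧ H p < h} with hI
  have hIopen : IsOpen I := D.continuousOn_disc.isOpen_inter_preimage D.isOpen_disc isOpen_Iio
  have hIC : ∀ {r θ : ℝ}, 0 ≤ r → (r • unitVec θ ∈ I ∪ C ↔ r ≤ R θ) := fun {r θ} hr => by
    rw [mem_union, hR.mem_sublevel_iff hr, hC, hR.range_eq, le_iff_lt_or_eq, mem_ofPred_eq,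
      D.smul_unitVec_mem_disc hr]
    refine or_congr_right ⟨fun ⟨h1, h2⟩ => ?_, fun h1 => ?_⟩
    · exact (D.strictMonoOn_ray θ).injOn ⟨hr, h1⟩ ⟨(hR.pos θ).le, hR.lt_delta θ⟩
        (h2.trans (hR.level θ).symm)
    · rw [h1]
      exact ⟨hR.lt_delta θ, hR.level θ⟩
  have hclosed : IsClosed (I ∪ C) := by
    have himage : I ∪ C = (fun q : ℝ × ℝ => (q.1 * R q.2) • unitVec q.2) ''
        (Icc 0 1 ×ˢ Icc (-π) π) := by
      ext p
      constructor
      · intro hp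
        obtain ⟨r, θ, hr, hθ, rfl⟩ := exists_eq_smul_unitVec p
        rw [hIC hr] at hp
        have := hR.pos θ
        refine ⟨(r / R θ, θ), ⟨⟨by positivity, (div_le_one this).mpr hp⟩, hθ⟩, ?_⟩
        simp only
        rw [div_mul_cancel₀ _ this.ne']
      · rintro ⟨⟨s, θ⟩, ⟨hs, -⟩, rfl⟩
        have := hR.pos θ
        simp only
        rw [hIC (mul_nonneg hs.1 this.le)]
        exact mul_le_of_le_one_left this.le hs.2
    rw [himage]
    refine ((isCompact_Icc.prod isCompact_Icc).image ?_).isClosed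
    have := continuous_unitVec
    fun_prop
  have hdisj : Disjoint I C := by
    rw [Set.disjoint_left, hC, hR.range_eq]
    exact fun p h1 h2 => h1.2.ne h2.2
  ext z
  constructor
  · rintro ⟨hzC, hbdd⟩
    by_contra hzI
    obtain ⟨r, θ, hr, _, rfl⟩ := exists_eq_smul_unitVec z
    have hrR : R θ < r := not_le.mp fun hle => ((hIC hr).mpr hle).elim hzI hzC
    have hsub : (fun s : ℝ => s • unitVec θ) '' Ici r ⊆ Cᶜ := by
      rintro _ ⟨s, hs, rfl⟩ hsC
      have hs' : r ≤ s := hs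
      have := (hIC (hr.trans hs')).mp (Or.inr hsC)
      linarith
    have hpre : IsPreconnected ((fun s : ℝ => s • unitVec θ) '' Ici r) :=
      isPreconnected_Ici.image _ (by fun_prop)
    have hcomp := hpre.subset_connectedComponentIn ⟨r, self_mem_Ici, rfl⟩ hsub
    obtain ⟨M, hM⟩ := (hbdd.subset hcomp).exists_norm_le
    have hM' := hM _ ⟨max r (2 * |M| + 1), mem_Ici.mpr (le_max_left _ _), rfl⟩
    set s := max r (2 * |M| + 1)
    have h1 : |(s • unitVec θ).1| ≤ |M| := (norm_fst_le _).trans (hM'.trans (le_abs_self _))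
    have h2 : |(s • unitVec θ).2| ≤ |M| := (norm_snd_le _).trans (hM'.trans (le_abs_self _))
    have h3 := unitVec_sq_add_sq s θ
    have h4 : 2 * |M| + 1 ≤ s := le_max_right _ _
    have h5 := sq_le_sq' (by linarith [abs_nonneg (s • unitVec θ).1]) h1
    have h6 := sq_le_sq' (by linarith [abs_nonneg (s • unitVec θ).2]) h2
    rw [sq_abs] at h5 h6
    nlinarith [abs_nonneg M]
  · intro hz
    have hzC : z ∈ Cᶜ := Set.disjoint_left.mp hdisj hz
    refine ⟨hzC, ?_⟩
    have hsub : connectedComponentIn Cᶜ z ⊆ I := by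
      refine isPreconnected_connectedComponentIn.subset_left_of_subset_union hIopen
        hclosed.isOpen_compl ?_ ?_ ⟨z, mem_connectedComponentIn hzC, hz⟩
      · exact Set.disjoint_left.mpr fun p h1 h2 => h2 (Or.inl h1)
      · intro p hp
        have hpC := connectedComponentIn_subset _ _ hp
        by_cases hpI : p ∈ I
        · exact Or.inl hpI
        · exact Or.inr fun h => h.elim hpI hpC
    refine (Metric.isBounded_ball (x := (0 : ℝ × ℝ)) (r := D.δ)).subset (hsub.trans fun p hp => ?_)
    obtain ⟨r, θ, hr, _, rfl⟩ := exists_eq_smul_unitVec p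
    have := (D.smul_unitVec_mem_disc hr).mp hp.1
    rw [mem_ball_zero_iff]
    exact smul_unitVec_norm_lt (by rwa [abs_of_nonneg hr])

theorem zero_mem_enclosed : (0 : ℝ × ℝ) ∈ enclosed (range fun θ => R θ • unitVec θ) := by
  rw [hR.enclosed_eq, ← zero_smul ℝ (unitVec 0), hR.mem_sublevel_iff le_rfl]
  exact hR.pos 0

theorem volume_enclosed : volume.real (enclosed (range fun θ => R θ • unitVec θ)) =
    (∫ θ in (π / 2)..(π / 2 + 2 * π), R θ ^ 2) / 2 := by
  rw [hR.enclosed_eq]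
  set I := {p | p ∈ D.disc ∧ H p < h} with hI
  have hIopen : IsOpen I := D.continuousOn_disc.isOpen_inter_preimage D.isOpen_disc isOpen_Iio
  have hmeas : MeasurableSet {q : ℝ × ℝ | q.1 < R q.2} :=
    measurableSet_lt measurable_fst (R.continuous.measurable.comp measurable_snd)
  have hinner : ∀ θ, ∫⁻ r in Ioi 0, {q : ℝ × ℝ | q.1 < R q.2}.indicator
      (fun q => ENNReal.ofReal q.1) (r, θ) = ENNReal.ofReal (R θ ^ 2 / 2) := fun θ => by
    have h1 : ∀ r, {q : ℝ × ℝ | q.1 < R q.2}.indicator (fun q => ENNReal.ofReal q.1) (r, θ) =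
        (Iio (R θ)).indicator (fun r => ENNReal.ofReal r) r := fun r => by
      by_cases hr : r < R θ <;> simp [hr]
    simp_rw [h1]
    rw [setLIntegral_indicator measurableSet_Iio, Iio_inter_Ioi, restrict_Ioo_eq_restrict_Ioc,
      ← ofReal_integral_eq_lintegral_ofReal, ← intervalIntegral.integral_of_le (hR.pos θ).le,
      integral_id]
    · simp
    · exact continuous_id.integrableOn_Ioc
    · exact (ae_restrict_mem measurableSet_Ioc).mono fun r hr => hr.1.le
  have hvol : volume I = ENNReal.ofReal (∫ θ in (-π)..π, R θ ^ 2 / 2) := by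
    rw [← lintegral_indicator_one hIopen.measurableSet, ← lintegral_comp_polarCoord_symm]
    have h2 : ∫⁻ p in polarCoord.target, ENNReal.ofReal p.1 • I.indicator 1 (polarCoord.symm p) =
        ∫⁻ p in polarCoord.target,
          {q : ℝ × ℝ | q.1 < R q.2}.indicator (fun q => ENNReal.ofReal q.1) p := by
      refine setLIntegral_congr_fun polarCoord.open_target.measurableSet fun p hp => ?_
      have hp0 : 0 ≤ p.1 := le_of_lt hp.1
      have hiff : polarCoord.symm p ∈ I ↔ p.1 < R p.2 := hR.mem_sublevel_iff hp0
      by_cases hpr : p.1 < R p.2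
      · rw [indicator_of_mem (hiff.mpr hpr), indicator_of_mem (by exact hpr)]
        simp
      · rw [indicator_of_notMem (hiff.not.mpr hpr), indicator_of_notMem (by exact hpr), smul_zero]
    rw [h2, polarCoord_target, Measure.volume_eq_prod, ← Measure.prod_restrict, lintegral_prod_symm]
    · simp_rw [hinner]
      rw [restrict_Ioo_eq_restrict_Ioc, ← ofReal_integral_eq_lintegral_ofReal,
        ← intervalIntegral.integral_of_le (by linarith [pi_pos])]
      · have : Continuous fun θ => R θ ^ 2 / 2 := (R.continuous.pow 2).div_const 2
        exact this.integrableOn_Ioc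
      · exact Eventually.of_forall fun θ => by positivity
    · exact ((ENNReal.measurable_ofReal.comp measurable_fst).indicator hmeas).aemeasurable
  have hper : Function.Periodic (fun θ => R θ ^ 2 / 2) (2 * π) := fun θ => by
    simp only [hR.periodic θ]
  -- Polar coordinates use the angles from -π to π; periodicity moves the turn to the one starting
  -- at π/2.
  have hshift := hper.intervalIntegral_add_eq (-π) (π / 2)
  rw [show -π + 2 * π = π by ring] at hshift
  rw [Measure.real, hvol, hshift, ENNReal.toReal_ofReal, intervalIntegral.integral_div]
  exact intervalIntegral.integral_nonneg (by linarith [pi_pos]) fun θ _ => by positivity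

end IsOval

end PolarForm

end Oval

/-! ### The area as an analytic function of the energy, and its derivative. -/

section PeriodFunction

open BoundedContinuousFunction
open scoped ContDiff

/-- Integration over an interval as a continuous linear functional. -/
theorem exists_integralCLM (a b : ℝ) :
    ∃ J : (ℝ →ᵇ ℝ) →L[ℝ] ℝ, ∀ f : ℝ →ᵇ ℝ, J f = ∫ θ in a..b, f θ := by
  refine ⟨LinearMap.mkContinuous
    { toFun := fun f : ℝ →ᵇ ℝ => ∫ θ in a..b, f θ
      map_add' := fun f g => intervalIntegral.integral_add (f.continuous.intervalIntegrable _ _)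
        (g.continuous.intervalIntegrable _ _)
      map_smul' := fun c f => intervalIntegral.integral_const_mul c _ } |b - a| fun f => ?_,
    fun f => rfl⟩
  rw [mul_comm]
  exact intervalIntegral.norm_integral_le_of_norm_le_const fun θ _ => f.norm_coe_le_norm θ

theorem AnalyticAt.exists_local_inverse {S : ℝ → ℝ} (hS : AnalyticAt ℝ S 0) (hS0 : S 0 = 0)
    (hS' : deriv S 0 ≠ 0) :
    ∃ Z : ℝ → ℝ, AnalyticAt ℝ Z 0 ∧ Z 0 = 0 ∧ ∀ᶠ ρ in 𝓝 0, S (Z ρ) = ρ := by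
  have hd : HasFDerivAt S
      ((ContinuousLinearEquiv.unitsEquivAut ℝ (Units.mk0 _ hS') : ℝ ≃L[ℝ] ℝ) : ℝ →L[ℝ] ℝ) 0 := by
    have := hS.differentiableAt.hasDerivAt.hasFDerivAt
    convert! this using 1
  have hcd : ContDiffAt ℝ ω S 0 := hS.contDiffAt
  have hs := hcd.hasStrictFDerivAt' hd (by simp)
  refine ⟨hcd.localInverse hd (by simp), ?_, ?_, ?_⟩
  · have := (hcd.to_localInverse hd (by simp)).analyticAt
    rwa [hS0] at this
  · have := hcd.localInverse_apply_image hd (by simp)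
    rwa [hS0] at this
  · have := hs.eventually_right_inverse
    rwa [hS0] at this

namespace PolarForm

variable {H : ℝ × ℝ → ℝ}

/-- `r = R z θ` is the polar equation of the level curve `{H = z ^ 2}` for all small `z`. -/
structure IsOvalFamily (D : PolarForm H) (R : ℝ → (ℝ →ᵇ ℝ)) : Prop where
  analyticAt : AnalyticAt ℝ R 0
  zero : R 0 = 0
  level : ∀ᶠ z in 𝓝 0, ∀ θ, H (R z θ • unitVec θ) = z ^ 2
  odd : ∀ᶠ z in 𝓝 0, ∀ θ, R (-z) θ = -R z (θ + π)
  periodic : ∀ᶠ z in 𝓝 0, Function.Periodic (R z) (2 * π)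
  exists_le : ∃ w > 0, ∀ᶠ z in 𝓝 0, ∀ θ, w * z ^ 2 ≤ z * R z θ
  oval : ∀ᶠ z in 𝓝[>] 0, D.IsOval (z ^ 2) (R z)

theorem exists_isOvalFamily (D : PolarForm H) : ∃ R, D.IsOvalFamily R := by
  obtain ⟨R, hR, hR0, w, hw, h⟩ := D.exists_levelCurve
  have hneg : Tendsto (fun z : ℝ => -z) (𝓝 0) (𝓝 0) := by simpa using (continuous_neg.tendsto (0 : ℝ))
  -- Applying the symmetry at z and at -z shifts the angle by 2π and restores the sign.
  have hper : ∀ᶠ z in 𝓝 0, Function.Periodic (R z) (2 * π) := by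
    filter_upwards [h, hneg.eventually h] with z h1 h2 θ
    have e1 := (h1.2 (θ + π)).2.1
    have e2 := (h2.2 θ).2.1
    rw [neg_neg] at e2
    rw [e2, e1, neg_neg, two_mul, add_assoc]
  refine ⟨R, hR, hR0, h.mono fun z hz θ => (hz.2 θ).1, h.mono fun z hz θ => (hz.2 θ).2.1, hper,
    ⟨w, hw, h.mono fun z hz θ => (hz.2 θ).2.2⟩, ?_⟩
  filter_upwards [nhdsWithin_le_nhds h, nhdsWithin_le_nhds hper, self_mem_nhdsWithin] with z h1 h2 hz
  have hz' : 0 < z := hz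
  refine ⟨h1.1, fun θ => ?_, fun θ => (h1.2 θ).1, h2⟩
  have h3 := (h1.2 θ).2.2
  have h4 : 0 < w * z ^ 2 := by positivity
  exact pos_of_mul_pos_right (h4.trans_le h3) hz'.le

theorem hasDerivAt_vertical (D : PolarForm H) (h0 : hamField H 0 = 0) :
    HasDerivAt (fun ρ : ℝ => H (0, ρ)) 0 0 := by
  have h1 := hasDerivAt_ray (D.differentiableAt_ray (r := 0) (π / 2) (by simpa using D.δ_pos))
  have h2 : angularComp H 0 (π / 2) = 0 := by simp [angularComp, h0]
  rw [h2] at h1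
  simpa [smul_unitVec] using h1

namespace IsOvalFamily

variable {D : PolarForm H} {R : ℝ → (ℝ →ᵇ ℝ)} (hR : D.IsOvalFamily R)
include hR

/-- The area and the period functions. -/
theorem exists_area : ∃ A : ℝ → ℝ, AnalyticAt ℝ A 0 ∧ A 0 = 0 ∧
    (∀ᶠ z in 𝓝 0, (∫ θ in (π / 2)..(π / 2 + 2 * π), R z θ ^ 2) / 2 = A (z ^ 2)) ∧
    ∀ᶠ z in 𝓝[>] 0,
      ∫ θ in (π / 2)..(π / 2 + 2 * π), (D.angular (R z) θ)⁻¹ = deriv A (z ^ 2) := by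
  obtain ⟨J, hJ⟩ := exists_integralCLM (π / 2) (π / 2 + 2 * π)
  set B : ℝ → ℝ := fun z => J (R z ^ 2) / 2 with hB
  have hBint : ∀ z, B z = (∫ θ in (π / 2)..(π / 2 + 2 * π), R z θ ^ 2) / 2 := fun z => by
    simp [hB, hJ]
  have hBA : AnalyticAt ℝ B 0 := ((J.analyticAt _).comp (hR.analyticAt.pow 2)).div_const
  have heven : ∀ᶠ z in 𝓝 0, B (-z) = B z := by
    filter_upwards [hR.odd, hR.periodic] with z h1 h2
    rw [hBint, hBint]
    simp_rw [h1, neg_sq]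
    have hper : Function.Periodic (fun θ => R z θ ^ 2) (2 * π) := fun θ => by simp only [h2 θ]
    rw [intervalIntegral.integral_comp_add_right (fun θ => R z θ ^ 2),
      ← hper.intervalIntegral_add_eq (π / 2 + π) (π / 2),
      show π / 2 + 2 * π + π = π / 2 + π + 2 * π by ring]
  obtain ⟨A, hA, hBz⟩ := hBA.exists_eq_comp_sq heven
  refine ⟨A, hA, ?_, hBz.mono fun z hz => by rw [← hz, hBint], ?_⟩
  · have := hBz.self_of_nhds
    rw [hBint, hR.zero] at this
    simpa using this.symm
  · have hsq : Tendsto (fun z : ℝ => z ^ 2) (𝓝 0) (𝓝 0) := by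
      have : Continuous fun z : ℝ => z ^ 2 := by fun_prop
      simpa using this.tendsto 0
    filter_upwards [nhdsWithin_le_nhds hBz.eventually_nhds,
      nhdsWithin_le_nhds hR.level.eventually_nhds, nhdsWithin_le_nhds hR.analyticAt.eventually_analyticAt,
      nhdsWithin_le_nhds (hsq.eventually hA.eventually_analyticAt), hR.oval, self_mem_nhdsWithin]
      with z h1 h2 h3 h4 h5 hz
    have hz0 : z ≠ 0 := (show 0 < z from hz).ne'
    have hd := h3.differentiableAt.hasDerivAt
    have hdθ : ∀ θ, HasDerivAt (fun z => R z θ) (deriv R z θ) z := fun θ =>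
      (BoundedContinuousFunction.evalCLM ℝ θ : (ℝ →ᵇ ℝ) →L[ℝ] ℝ).hasFDerivAt.comp_hasDerivAt z hd
    -- Differentiation of H(R e_θ) = z² in z at fixed θ, using ∂H/∂r = R θ'.
    have hprod : ∀ θ, R z θ * deriv R z θ = 2 * z * (D.angular (R z) θ)⁻¹ := fun θ => by
      have e1 := (hasDerivAt_ray (D.differentiableAt_ray θ (h5.abs_lt_delta θ))).comp z (hdθ θ)
      have e2 : HasDerivAt (fun z : ℝ => z ^ 2) (2 * z) z := by simpa using hasDerivAt_pow 2 z
      have e3 := (e1.congr_of_eventuallyEq (f₁ := fun z => z ^ 2)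
        (h2.mono fun y hy => (hy θ).symm)).unique e2
      rw [← D.mul_angular_apply _ h5.norm_lt] at e3
      have := (h5.angular_pos θ).ne'
      rw [eq_mul_inv_iff_mul_eq₀ this]
      linarith
    have hBd : HasDerivAt B (J (R z * deriv R z)) z := by
      have e1 := (J.hasFDerivAt.comp_hasDerivAt z (hd.pow 2)).div_const 2
      convert! e1 using 1
      have : R z * deriv R z = (1 / 2 : ℝ) • ((2 : ℕ) * R z ^ (2 - 1) * deriv R z) := by
        ext θ
        simp
        ring
      rw [this, map_smul, smul_eq_mul]
      ring
    have hAd : HasDerivAt B (deriv A (z ^ 2) * (2 * z)) z := by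
      have e2 : HasDerivAt (fun z : ℝ => z ^ 2) (2 * z) z := by simpa using hasDerivAt_pow 2 z
      exact (HasDerivAt.comp (h₂ := A) (h := fun z : ℝ => z ^ 2) z
        h4.differentiableAt.hasDerivAt e2).congr_of_eventuallyEq h1
    have heq := hBd.unique hAd
    rw [hJ] at heq
    simp only [BoundedContinuousFunction.mul_apply, hprod] at heq
    rw [intervalIntegral.integral_const_mul, mul_comm] at heq
    exact mul_right_cancel₀ (mul_ne_zero two_ne_zero hz0) heq

end IsOvalFamily

end PolarForm

end PeriodFunction

/-! ### The Taylor series of the period in the starting point. -/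

section PeriodSeries

open BoundedContinuousFunction

namespace PolarForm

variable {H : ℝ × ℝ → ℝ} (D : PolarForm H)

theorem isUnit_angular {R : ℝ →ᵇ ℝ} (hR : ‖R‖ < D.δ) : IsUnit (D.angular R) := by
  have hle := D.le_angular R hR
  have hpos : ∀ θ, 0 < D.angular R θ := fun θ => D.κ_pos.trans_le (hle θ)
  refine IsUnit.of_mul_eq_one (BoundedContinuousFunction.ofNormedAddCommGroup
    (fun θ => (D.angular R θ)⁻¹) ((D.angular R).continuous.inv₀ fun θ => (hpos θ).ne') D.κ⁻¹
    fun θ => ?_) ?_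
  · rw [norm_inv, Real.norm_of_nonneg (hpos θ).le]
    exact inv_anti₀ D.κ_pos (hle θ)
  · ext θ
    exact mul_inv_cancel₀ (hpos θ).ne'

/-- The superposition operator of `dt / dθ`. -/
noncomputable def time (R : ℝ →ᵇ ℝ) : ℝ →ᵇ ℝ := Ring.inverse (D.angular R)

theorem time_apply {R : ℝ →ᵇ ℝ} (hR : ‖R‖ < D.δ) (θ : ℝ) : D.time R θ = (D.angular R θ)⁻¹ :=
  eq_inv_of_mul_eq_one_right
    (DFunLike.congr_fun (Ring.mul_inverse_cancel _ (D.isUnit_angular hR)) θ)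

theorem analyticAt_time : AnalyticAt ℝ D.time 0 := by
  obtain ⟨v, hv⟩ := D.isUnit_angular (R := 0) (by simpa using D.δ_pos)
  exact (analyticAt_inverse (𝕜 := ℝ) v).comp_of_eq D.analyticAt_angular hv.symm

/-- The superposition operator of `dr / dθ`. -/
noncomputable def orbit (R : ℝ →ᵇ ℝ) : ℝ →ᵇ ℝ := D.radial R * D.time R

theorem orbit_apply {R : ℝ →ᵇ ℝ} (hR : ‖R‖ < D.δ) (θ : ℝ) :
    D.orbit R θ = D.radial R θ / D.angular R θ := by
  rw [orbit, BoundedContinuousFunction.mul_apply, D.time_apply hR, div_eq_mul_inv]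

theorem analyticAt_orbit : AnalyticAt ℝ D.orbit 0 := D.analyticAt_radial.mul D.analyticAt_time

theorem _root_.AnalyticAt.comp_smul_one {F : (ℝ →ᵇ ℝ) → (ℝ →ᵇ ℝ)} (hF : AnalyticAt ℝ F 0) :
    AnalyticAt ℝ (fun r : ℝ => F (r • (1 : ℝ →ᵇ ℝ))) 0 :=
  hF.comp_of_eq (by fun_prop) (zero_smul ℝ _)

theorem eventually_norm_lt {u : ℝ → (ℝ →ᵇ ℝ)} (hu : AnalyticAt ℝ u 0) (hu0 : u 0 = 0) :
    ∀ᶠ r in 𝓝 0, ‖u r‖ < D.δ :=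
  hu.continuousAt.norm.eventually_lt continuousAt_const (by simpa [hu0] using D.δ_pos)

/-- Evaluating the operator on the constant functions r • 1 recovers the dependence on r at a fixed
angle, which ties the formal series of the algorithm to the operators. -/
theorem polarRadial_eq (θ : ℝ) :
    polarRadial H θ = taylorSeries fun r => D.radial (r • (1 : ℝ →ᵇ ℝ)) θ := by
  refine taylorSeries_congr (f := fun r => radialComp H r θ) ?_
  filter_upwards [D.eventually_norm_lt (u := fun r => r • (1 : ℝ →ᵇ ℝ)) (by fun_prop) (by simp)]
    with r hr
  rw [D.radial_apply _ hr]
  simp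

theorem polarAngular_eq (θ : ℝ) :
    polarAngular H θ = taylorSeries fun r => D.angular (r • (1 : ℝ →ᵇ ℝ)) θ := by
  have h : (fun r => angularComp H r θ) =ᶠ[𝓝 0] fun r => r * D.angular (r • (1 : ℝ →ᵇ ℝ)) θ := by
    filter_upwards [D.eventually_norm_lt (u := fun r => r • (1 : ℝ →ᵇ ℝ)) (by fun_prop) (by simp)]
      with r hr
    have := D.mul_angular_apply _ hr θ
    simpa using this.symm
  ext n
  rw [polarAngular, PowerSeries.coeff_mk]
  change taylorCoeff (fun r => angularComp H r θ) (n + 1) = _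
  rw [← coeff_taylorSeries, taylorSeries_congr h, taylorSeries_mul (by fun_prop)
    (D.analyticAt_angular.comp_smul_one.eval_apply θ), taylorSeries_id,
    PowerSeries.coeff_succ_X_mul]

theorem timeSeries_eq (θ : ℝ) :
    timeSeries H θ = taylorSeries fun r => D.time (r • (1 : ℝ →ᵇ ℝ)) θ := by
  rw [timeSeries, D.polarAngular_eq, ← taylorSeries_inv
    (D.analyticAt_angular.comp_smul_one.eval_apply θ)]
  · refine taylorSeries_congr ?_
    filter_upwards [D.eventually_norm_lt (u := fun r => r • (1 : ℝ →ᵇ ℝ)) (by fun_prop) (by simp)]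
      with r hr
    rw [D.time_apply hr]
  · have := D.le_angular ((0 : ℝ) • (1 : ℝ →ᵇ ℝ)) (by simpa using D.δ_pos) θ
    exact (D.κ_pos.trans_le this).ne'

theorem orbitSeries_eq (θ : ℝ) :
    orbitSeries H θ = taylorSeries fun r => D.orbit (r • (1 : ℝ →ᵇ ℝ)) θ := by
  have h : orbitSeries H θ = polarRadial H θ * timeSeries H θ := rfl
  rw [h, D.polarRadial_eq, D.timeSeries_eq, ← taylorSeries_mul
    (D.analyticAt_radial.comp_smul_one.eval_apply θ) (D.analyticAt_time.comp_smul_one.eval_apply θ)]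
  rfl

/-- Locality: the value at θ depends on R only through R(θ). The polar form determines the operator
only through R θ', so the factor R(θ) must be cancelled. -/
theorem angular_eq_of_ne_zero {R : ℝ →ᵇ ℝ} (hR : ‖R‖ < D.δ) {θ : ℝ} (h0 : R θ ≠ 0) :
    D.angular (R θ • (1 : ℝ →ᵇ ℝ)) θ = D.angular R θ := by
  have h1 := D.mul_angular_apply R hR θ
  have h2 := D.mul_angular_apply _ (D.norm_smul_one_lt ((R.norm_coe_le_norm θ).trans_lt hR)) θ
  have h3 : (R θ • (1 : ℝ →ᵇ ℝ)) θ = R θ := by simp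
  rw [h3, ← h1] at h2
  exact mul_left_cancel₀ h0 h2

theorem time_eq_of_ne_zero {R : ℝ →ᵇ ℝ} (hR : ‖R‖ < D.δ) {θ : ℝ} (h0 : R θ ≠ 0) :
    D.time (R θ • (1 : ℝ →ᵇ ℝ)) θ = D.time R θ := by
  rw [D.time_apply hR, D.time_apply (D.norm_smul_one_lt ((R.norm_coe_le_norm θ).trans_lt hR)),
    D.angular_eq_of_ne_zero hR h0]

theorem orbit_eq_of_ne_zero {R : ℝ →ᵇ ℝ} (hR : ‖R‖ < D.δ) {θ : ℝ} (h0 : R θ ≠ 0) :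
    D.orbit (R θ • (1 : ℝ →ᵇ ℝ)) θ = D.orbit R θ := by
  have h1 := D.norm_smul_one_lt ((R.norm_coe_le_norm θ).trans_lt hR)
  have h3 : (R θ • (1 : ℝ →ᵇ ℝ)) θ = R θ := by simp
  rw [orbit, orbit, BoundedContinuousFunction.mul_apply, BoundedContinuousFunction.mul_apply,
    D.time_eq_of_ne_zero hR h0, D.radial_apply R hR, D.radial_apply _ h1, h3]

/-- The Taylor coefficients of a superposition along a family of ovals. -/
theorem taylorCoeff_superposition {F : (ℝ →ᵇ ℝ) → (ℝ →ᵇ ℝ)} (hF : AnalyticAt ℝ F 0)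
    (hloc : ∀ R : ℝ →ᵇ ℝ, ‖R‖ < D.δ → ∀ θ, R θ ≠ 0 → F (R θ • (1 : ℝ →ᵇ ℝ)) θ = F R θ)
    {u : ℝ → (ℝ →ᵇ ℝ)} (hu : AnalyticAt ℝ u 0) (hu0 : u 0 = 0)
    (hoval : ∀ᶠ ρ in 𝓝[>] 0, ∃ h, D.IsOval h (u ρ)) (θ : ℝ) :
    taylorCoeff (fun ρ => F (u ρ) θ) =
      taylorCoeff fun ρ => (fun r : ℝ => F (r • (1 : ℝ →ᵇ ℝ)) θ) (u ρ θ) := by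
  refine taylorCoeff_congr (AnalyticAt.eventuallyEq_of_nhdsGT
    (AnalyticAt.eval_apply (hF.comp_of_eq hu hu0) θ) ?_ ?_)
  · exact AnalyticAt.comp_of_eq (hF.comp_smul_one.eval_apply θ) (hu.eval_apply θ) (by simp [hu0])
  · filter_upwards [hoval] with ρ ⟨h, hρ⟩
    exact (hloc _ hρ.norm_lt θ (hρ.pos θ).ne').symm

/-- The Taylor coefficients of the period of the orbits `r = u ρ θ` parametrized by their
intersection `ρ = u ρ (π / 2)` with a half-axis. -/
theorem taylorCoeff_period (h0 : hamField H 0 = 0) {u : ℝ → (ℝ →ᵇ ℝ)} (hu : AnalyticAt ℝ u 0)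
    (hu0 : u 0 = 0) (hoval : ∀ᶠ ρ in 𝓝[>] 0, ∃ h, D.IsOval h (u ρ))
    (hinit : ∀ᶠ ρ in 𝓝[>] 0, u ρ (π / 2) = ρ) {P : ℝ → ℝ} (hP : AnalyticAt ℝ P 0)
    (hPu : ∀ᶠ ρ in 𝓝[>] 0,
      P ρ = ∫ θ in (π / 2)..(π / 2 + 2 * π), (D.angular (u ρ) θ)⁻¹) (n : ℕ) :
    taylorCoeff P n = periodCoeff H n := by
  have hFu : AnalyticAt ℝ (fun ρ => D.orbit (u ρ)) 0 := D.analyticAt_orbit.comp_of_eq hu hu0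
  have hGu : AnalyticAt ℝ (fun ρ => D.time (u ρ)) 0 := D.analyticAt_time.comp_of_eq hu hu0
  set U : ℕ → ℝ → ℝ := fun j s => taylorCoeff (fun ρ => u ρ s) j with hU
  have hus : ∀ s, AnalyticAt ℝ (fun ρ => u ρ s) 0 := fun s => hu.eval_apply s
  -- A Taylor coefficient of a map into `ℝ →ᵇ ℝ` is itself an element of it. Hence the coefficients
  -- are continuous in the angle and commute with integration.
  have heval : ∀ (f : ℝ → (ℝ →ᵇ ℝ)), AnalyticAt ℝ f 0 → ∀ n, ∃ c : ℝ →ᵇ ℝ,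
      (∀ s, taylorCoeff (fun ρ => f ρ s) n = c s) ∧
      ∀ a b, AnalyticAt ℝ (fun ρ => ∫ s in a..b, f ρ s) 0 ∧
        taylorCoeff (fun ρ => ∫ s in a..b, f ρ s) n = ∫ s in a..b, c s := fun f hf n => by
    obtain ⟨c, hc⟩ := exists_taylorCoeff_clm hf n
    refine ⟨c, fun s => hc (BoundedContinuousFunction.evalCLM ℝ s), fun a b => ?_⟩
    obtain ⟨J, hJ⟩ := exists_integralCLM a b
    simp_rw [← hJ]
    exact ⟨(J.analyticAt _).comp hf, hc J⟩
  have hΦ : ∀ n s, PowerSeries.coeff n (∑ m ∈ Finset.range (n + 1),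
      PowerSeries.C (PowerSeries.coeff m (orbitSeries H s)) *
        PowerSeries.mk (fun j => U j s) ^ m) = taylorCoeff (fun ρ => D.orbit (u ρ) s) n := by
    intro n s
    rw [D.taylorCoeff_superposition D.analyticAt_orbit
      (fun R hR θ => D.orbit_eq_of_ne_zero hR) hu hu0 hoval s,
      taylorCoeff_comp (D.analyticAt_orbit.comp_smul_one.eval_apply s) (hus s) (by simp [hu0])
        n.lt_succ_self, D.orbitSeries_eq s]
    simp_rw [coeff_taylorSeries]
    rfl
  have hsol : ∀ n θ, solutionCoeff (orbitSeries H) n θ = U n θ := by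
    refine solutionCoeff_eq_of_integral_equation (fun s => ?_) ?_ (fun s => ?_) (fun n => ?_)
      (fun n => ?_) fun n θ => ?_
    · rw [D.orbitSeries_eq, coeff_taylorSeries, taylorCoeff_zero, zero_smul,
        D.orbit_apply (by simpa using D.δ_pos), D.radial_apply 0 (by simpa using D.δ_pos)]
      simp [radialComp, h0]
    · obtain ⟨c, hc, -⟩ := heval _ D.analyticAt_orbit.comp_smul_one 1
      simp_rw [D.orbitSeries_eq, coeff_taylorSeries, hc]
      exact c.continuous
    · simp [hU, hu0]
    · obtain ⟨c, hc, -⟩ := heval _ hu n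
      simp only [hU, hc]
      exact c.continuous
    · obtain ⟨c, hc, -⟩ := heval _ hFu n
      simp_rw [hΦ, hc]
      exact c.continuous
    · obtain ⟨c, hc, hint⟩ := heval _ hFu n
      obtain ⟨hA, hT⟩ := hint (π / 2) θ
      -- The integral equation holds for ρ > 0, where the curves are ovals; analyticity of both
      -- sides extends it to a neighbourhood of 0.
      have heq : (fun ρ => u ρ θ) =ᶠ[𝓝 0]
          fun ρ => ρ + ∫ s in (π / 2)..θ, D.orbit (u ρ) s := by
        refine AnalyticAt.eventuallyEq_of_nhdsGT (hus θ) (analyticAt_id.fun_add hA) ?_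
        filter_upwards [hoval, hinit] with ρ ⟨h, hρ⟩ h1
        have hder : ∀ s ∈ uIcc (π / 2) θ, HasDerivAt (u ρ) (D.orbit (u ρ) s) s := fun s _ => by
          rw [D.orbit_apply hρ.norm_lt]
          exact hρ.hasDerivAt s
        rw [intervalIntegral.integral_eq_sub_of_hasDerivAt hder
          ((D.orbit (u ρ)).continuous.intervalIntegrable _ _), h1]
        ring
      simp_rw [hΦ, hc]
      rw [← hT, hU]
      simp only
      rw [← coeff_taylorSeries, taylorSeries_congr heq, taylorSeries_add (by fun_prop) hA,
        taylorSeries_id, map_add, PowerSeries.coeff_X, coeff_taylorSeries]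
  obtain ⟨c, hc, hint⟩ := heval _ hGu n
  obtain ⟨hA, hT⟩ := hint (π / 2) (π / 2 + 2 * π)
  have hPeq : P =ᶠ[𝓝 0] fun ρ => ∫ θ in (π / 2)..(π / 2 + 2 * π), D.time (u ρ) θ := by
    refine AnalyticAt.eventuallyEq_of_nhdsGT hP hA ?_
    filter_upwards [hPu, hoval] with ρ h1 ⟨h, hρ⟩
    simp_rw [h1, D.time_apply hρ.norm_lt]
  rw [taylorCoeff_congr hPeq, hT, periodCoeff]
  refine intervalIntegral.integral_congr fun θ _ => ?_
  rw [← hc, D.taylorCoeff_superposition D.analyticAt_time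
    (fun R hR θ => D.time_eq_of_ne_zero hR) hu hu0 hoval θ,
    taylorCoeff_comp_trunc (D.analyticAt_time.comp_smul_one.eval_apply θ) (hus θ) (by simp [hu0]),
    D.timeSeries_eq θ]
  simp_rw [coeff_taylorSeries, hsol]
  rfl

end PolarForm

end PeriodSeries

/-! ### Assembly of the main theorem. -/

theorem theorem1 (H : ℝ × ℝ → ℝ) (hH : AnalyticAt ℝ H 0) (hH0 : H 0 = 0)
    (hcenter : IsNondegenerateCenter H) (hsign : ∀ᶠ z in 𝓝 (0 : ℝ × ℝ), 0 ≤ H z) :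
    ∃ T A P S : ℝ → ℝ,
      -- (i) the period function `T` and the area function `A`
      (IsPeriodFunction H T ∧ IsAreaFunction H A ∧
        AnalyticAt ℝ T 0 ∧ AnalyticAt ℝ A 0 ∧ ∀ᶠ h in 𝓝 (0 : ℝ), HasDerivAt A (T h) h) ∧
      -- (ii) the period `P ρ` of the orbit starting at `(0, ρ)`
      ((∀ᶠ ρ in 𝓝[>] (0 : ℝ), ∃ γ : ℝ → ℝ × ℝ, γ 0 = (0, ρ) ∧ IsPeriodicOrbit H γ (P ρ)) ∧
        AnalyticAt ℝ P 0 ∧ ∀ n : ℕ, taylorCoeff P n = periodCoeff H n) ∧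
      -- the positive solution `ρ = S (√h)` of `H (0, ρ) = h`
      ((∀ᶠ h in 𝓝[>] (0 : ℝ), 0 < S (√h) ∧ H (0, S (√h)) = h) ∧
        AnalyticAt ℝ S 0 ∧
        ∀ n : ℕ, taylorCoeff S n = levelCoeff (taylorCoeff fun ρ : ℝ => H (0, ρ)) n) ∧
      -- the period and area functions recovered from `P` and `S`
      ((∀ᶠ h in 𝓝[≥] (0 : ℝ), T h = P (S (√h))) ∧
        ∀ᶠ h in 𝓝[≥] (0 : ℝ), A h = ∫ s in (0 : ℝ)..h, T s) := by
  obtain ⟨D⟩ := exists_polarForm hH hH0 hcenter hsign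
  obtain ⟨R, hR⟩ := D.exists_isOvalFamily
  obtain ⟨A, hA, hA0, hAz, hTz⟩ := hR.exists_area
  have h0 := hcenter.singular
  have hT : AnalyticAt ℝ (deriv A) 0 := hA.deriv
  -- The positive y-axis is the ray of angle π/2, so S(z) is where the curve of energy z² crosses
  -- it.
  set S : ℝ → ℝ := fun z => R z (π / 2) with hS
  have hSA : AnalyticAt ℝ S 0 := hR.analyticAt.eval_apply _
  have hS0 : S 0 = 0 := by simp [hS, hR.zero]
  have hvec : ∀ r : ℝ, r • unitVec (π / 2) = (0, r) := fun r => by simp [smul_unitVec]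
  have hHS : ∀ᶠ z in 𝓝 0, H (0, S z) = z ^ 2 := hR.level.mono fun z hz => by
    rw [← hvec]; exact hz _
  obtain ⟨w, hw, hwz⟩ := hR.exists_le
  -- The slopes S(z)/z = z S(z)/z² are at least w.
  have hS1 : 0 < deriv S 0 := by
    refine hw.trans_le (ge_of_tendsto (hSA.differentiableAt.hasDerivAt.tendsto_slope) ?_)
    filter_upwards [nhdsWithin_le_nhds hwz, self_mem_nhdsWithin] with z hz hz0
    have hz0' : z ≠ 0 := hz0
    have hsq : 0 < z ^ 2 := by positivity
    rw [slope_def_field, hS0, sub_zero, sub_zero, show S z / z = z * S z / z ^ 2 by field_simp,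
      le_div_iff₀ hsq]
    exact hz _
  have hG : AnalyticAt ℝ (fun ρ : ℝ => H (0, ρ)) 0 :=
    AnalyticAt.comp_of_eq (g := H) (f := fun ρ : ℝ => ((0 : ℝ), ρ)) hH (by fun_prop) rfl
  obtain ⟨Z, hZ, hZ0, hSZ⟩ := hSA.exists_local_inverse hS0 hS1.ne'
  have hZlim : Tendsto Z (𝓝 0) (𝓝 0) := by simpa [hZ0] using hZ.continuousAt.tendsto
  have hZpos : Tendsto Z (𝓝[>] 0) (𝓝[>] 0) := by
    refine tendsto_nhdsWithin_iff.mpr ⟨hZlim.mono_left nhdsWithin_le_nhds, ?_⟩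
    filter_upwards [nhdsWithin_le_nhds hSZ, nhdsWithin_le_nhds (hZlim.eventually hwz),
      self_mem_nhdsWithin] with ρ h1 h2 hρ
    have hρ' : 0 < ρ := hρ
    have h3 : w * Z ρ ^ 2 ≤ Z ρ * ρ := (h2 (π / 2)).trans_eq (congrArg _ h1)
    have h4 : Z ρ ≠ 0 := fun h => by
      rw [h, hS0] at h1
      exact hρ'.ne h1
    have h5 : 0 < w * Z ρ ^ 2 := by positivity
    exact pos_of_mul_pos_left (h5.trans_le h3) hρ'.le
  -- The witness for ϖ(ρ) is T at the energy H(0, ρ) of the starting point.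
  have hPA : AnalyticAt ℝ (fun ρ : ℝ => deriv A (H (0, ρ))) 0 :=
    AnalyticAt.comp_of_eq (g := deriv A) (f := fun ρ : ℝ => H (0, ρ)) hT hG hH0
  have hHZ : ∀ᶠ ρ in 𝓝 0, H (0, ρ) = Z ρ ^ 2 := by
    filter_upwards [hSZ, hZlim.eventually hHS] with ρ h1 h2
    rwa [h1] at h2
  have hsqrt : Tendsto Real.sqrt (𝓝[>] 0) (𝓝[>] 0) := by
    refine tendsto_nhdsWithin_iff.mpr ⟨?_, ?_⟩
    · simpa using (Real.continuous_sqrt.tendsto 0).mono_left nhdsWithin_le_nhds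
    · filter_upwards [self_mem_nhdsWithin] with h hh using Real.sqrt_pos.mpr hh
  have hsqrt' : Tendsto Real.sqrt (𝓝 0) (𝓝 0) := by simpa using Real.continuous_sqrt.tendsto 0
  obtain ⟨h₁, hh₁, hIoo⟩ := mem_nhdsGT_iff_exists_Ioo_subset.mp
    ((hsqrt.eventually (hR.oval.and hTz)).and (hsqrt.eventually (nhdsWithin_le_nhds hAz)))
  have hoval : ∀ h ∈ Ioo 0 h₁, ∃ γ : ℝ → ℝ × ℝ, PolarForm.IsOval D h (R √h) ∧
      IsEnergyOval H D.disc h γ (deriv A h) ∧ A h = volume.real (enclosed (range γ)) := by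
    intro h hh
    obtain ⟨⟨h1, h2⟩, h3⟩ := hIoo hh
    rw [Real.sq_sqrt hh.1.le] at h1 h2 h3
    obtain ⟨γ, -, hγ, hrange⟩ := h1.exists_periodicOrbit
    rw [h2] at hγ
    refine ⟨γ, h1, ⟨hγ, ?_, ?_⟩, ?_⟩
    · rw [hrange, h1.range_eq]
    · rw [hrange]; exact h1.zero_mem_enclosed
    · rw [hrange, h1.volume_enclosed, h3]
  have hder : ∀ᶠ h in 𝓝 (0 : ℝ), HasDerivAt A (deriv A h) h :=
    hA.eventually_analyticAt.mono fun h hh => hh.differentiableAt.hasDerivAt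
  refine ⟨deriv A, A, fun ρ => deriv A (H (0, ρ)), S, ⟨?_, ?_, hT, hA, hder⟩, ⟨?_, hPA, ?_⟩,
    ⟨?_, hSA, ?_⟩, ?_, ?_⟩
  · exact ⟨D.disc, D.disc_mem_nhds, h₁, hh₁, fun h hh =>
      let ⟨γ, _, h2, _⟩ := hoval h hh; ⟨γ, h2⟩⟩
  · exact ⟨D.disc, D.disc_mem_nhds, h₁, hh₁, fun h hh =>
      let ⟨γ, _, h2, h3⟩ := hoval h hh; ⟨γ, _, h2, h3⟩⟩
  · filter_upwards [hZpos.eventually (hR.oval.and hTz), nhdsWithin_le_nhds hSZ,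
      nhdsWithin_le_nhds hHZ] with ρ ⟨h1, h2⟩ h3 h4
    obtain ⟨γ, hγ0, hγ, -⟩ := h1.exists_periodicOrbit
    rw [h2, ← h4] at hγ
    refine ⟨γ, ?_, hγ⟩
    rw [hγ0]
    exact congrArg _ h3
  -- Reparametrizing the ovals by Z makes each one start at radius ρ for the angle π/2.
  · refine D.taylorCoeff_period h0 (u := fun ρ => R (Z ρ)) (hR.analyticAt.comp_of_eq hZ hZ0) ?_ ?_ ?_
      hPA ?_
    · rw [hZ0, hR.zero]
    · exact (hZpos.eventually hR.oval).mono fun ρ hρ => ⟨_, hρ⟩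
    · exact nhdsWithin_le_nhds hSZ
    · filter_upwards [hZpos.eventually hTz, nhdsWithin_le_nhds hHZ] with ρ h2 h4
      rw [h2, h4]
  · filter_upwards [hsqrt.eventually hR.oval, nhdsWithin_le_nhds (hsqrt'.eventually hHS),
      self_mem_nhdsWithin] with h h1 h2 hh
    refine ⟨h1.pos _, ?_⟩
    rw [h2, Real.sq_sqrt (le_of_lt hh)]
  · refine levelCoeff_eq_taylorCoeff hG hSA hS0 ?_ hH0 ?_ hHS
    · rwa [taylorCoeff_one]
    · rw [taylorCoeff_one]
      exact (D.hasDerivAt_vertical h0).deriv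
  · filter_upwards [nhdsWithin_le_nhds (hsqrt'.eventually hHS), self_mem_nhdsWithin] with h h2 hh
    rw [h2, Real.sq_sqrt hh]
  · obtain ⟨ε, hε, hball⟩ := Metric.eventually_nhds_iff_ball.mp (hder.and hT.eventually_analyticAt)
    filter_upwards [nhdsWithin_le_nhds (Metric.ball_mem_nhds (0 : ℝ) hε), self_mem_nhdsWithin]
      with h h1 hh
    have hsub : uIcc 0 h ⊆ Metric.ball 0 ε := by
      rw [uIcc_of_le hh]
      intro s hs
      rw [mem_ball_zero_iff, Real.norm_of_nonneg hs.1]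
      rw [mem_ball_zero_iff, Real.norm_of_nonneg hh] at h1
      exact hs.2.trans_lt h1
    rw [intervalIntegral.integral_eq_sub_of_hasDerivAt (fun s hs => (hball s (hsub hs)).1)
      (ContinuousOn.intervalIntegrable fun s hs =>
        (hball s (hsub hs)).2.continuousAt.continuousWithinAt), hA0, sub_zero]
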